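/- Let $k$ be a field, let $G$ be a group with unit $\epsilon$, and let $R=\sum_C R_C\,C$ be a ramification datum, i.e. a family of numbers $R_C\in\mathbb N$ indexed by the conjugacy classes $C$ of $G$. The Hopf quiver $Q=Q(G,R)$ has vertex set $Q_0=G$ and, for each $x\in G$, each class $C$ and each $c\in C$, exactly $R_C$ arrows from $x$ to $cx$. The path coalgebra $kQ$ has as basis all paths of $Q$, with $\Delta(p)=\sum_{p=p''p'}p''\otimes p'$ (the sum over all ways to write $p$ as a concatenation, $p'$ being the initial piece), $\varepsilon(p)=1$ if $p$ is a vertex and $\varepsilon(p)=0$ otherwise; it is graded by path length, $kQ=\bigoplus_{n\ge0}kQ_n$. A graded coquasitriangular Hopf structure on $kQ$ consists of a multiplication, a unit and an antipode that make the coalgebra $kQ$ a graded Hopf algebra, together with a convolution-invertible linear form $\mathcal R:kQ\otimes kQ\to k$ such that, for all $a,b,c\in kQ$, $$\mathcal R(ab,c)=\mathcal R(a,c_1)\mathcal R(b,c_2),\qquad \mathcal R(a,bc)=\mathcal R(a_1,c)\mathcal R(a_2,b),\qquad b_1a_1\,\mathcal R(a_2,b_2)=\mathcal R(a_1,b_1)\,a_2b_2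 .$$ It has $Q_0=G$ if the product in $kQ$ of two vertices is their product in $G$, and $\mathcal R$ is concentrated in degree $0$ if $\mathcal R(x,y)=0$ for homogeneous $x,y$ unless both have degree $0$. Two such structures with $Q_0=G$ are isomorphic if there is an isomorphism of graded Hopf algebras between them that is the identity on $kQ_0=kG$ and carries one form $\mathcal R$ to the other. **Theorem 3.3.** Assume that $Q=Q(G,R)$ is connected (as an undirected graph) and is a coquasitriangular Hopf quiver, i.e. $kQ$ admits a graded coquasitriangular Hopf structure with $Q_0=G$. Then restricting $\mathcal R$ to $G\times G$ induces a bijection from the set of isomorphism classes of graded coquasitriangular Hopf structures $(kQ,\mathcal R)$ with $Q_0=G$ and $\mathcal R$ concentrated in degree $0$ onto the set of skew-symmetric bicharacters of $G$, i.e. functions $\mathcal R:G\times G\to k$ such that for all $f,g,h\in G$ $$\mathcal R(f,gh)=\mathcal R(f,g)\mathcal R(f,h),\quad \mathcal R(fg,h)=\mathcal R(f,h)\mathcal R(g,h),\quad \mathcal R(f,\epsilon)=1=\mathcal R(\epsilon,f),\quad \mathcal R(g,h)\mathcal R(h,g)=1 .$$ -/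

import Mathlib

open scoped TensorProduct

universe u v w

/-! ### The path coalgebra of a quiver -/

/-- All paths of a quiver, of any length and with any end points.
The path `a_n ⋯ a_1` is `((nil.cons a_1).cons a_2) ⋯ .cons a_n`. -/
def TotalPath (V : Type u) [Quiver.{v} V] : Type (max u v) :=
  Σ a b : V, Quiver.Path a b

namespace TotalPath

variable {V : Type u} [Quiver.{v} V]

/-- A path with given end points, as an element of the type of all paths. -/
def of {a b : V} (p : Quiver.Path a b) : TotalPath V := ⟨a, b, p⟩

/-- The length of a path. -/
def length (p : TotalPath V) : ℕ := p.2.2.length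

end TotalPath

/-- A way to write a path from `a` to `b` as a concatenation `later · earlier`. -/
structure PathSplit {V : Type u} [Quiver.{v} V] (a b : V) where
  /-- The vertex at which the path is cut. -/
  mid : V
  /-- The terminal piece. -/
  later : Quiver.Path mid b
  /-- The initial piece. -/
  earlier : Quiver.Path a mid

/-- The list of all `n + 1` splits of a path of length `n`. -/
def pathSplits {V : Type u} [Quiver.{v} V] {a : V} :
    ∀ {b : V}, Quiver.Path a b → List (PathSplit a b)
  | _, .nil => [⟨a, .nil, .nil⟩]
  | c, .cons p e =>
      ⟨c, .nil, p.cons e⟩ :: (pathSplits p).map fun s => ⟨s.mid, s.later.cons e, s.earlier⟩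

/-- The underlying vector space of the path coalgebra: the `k`-space with basis all paths.
(A separate type, because Mathlib equips a bare `Finsupp` with another coalgebra structure.) -/
def PathCoalgebra (k : Type w) [Field k] (V : Type u) [Quiver.{v} V] : Type (max u v w) :=
  TotalPath V →₀ k

namespace PathCoalgebra

variable (k : Type w) [Field k] {V : Type u} [Quiver.{v} V]

noncomputable instance : AddCommGroup (PathCoalgebra k V) :=
  inferInstanceAs (AddCommGroup (TotalPath V →₀ k))

noncomputable instance : Module k (PathCoalgebra k V) :=
  inferInstanceAs (Module k (TotalPath V →₀ k))

/-- The paths form a basis of the path coalgebra. -/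
noncomputable def basis : Module.Basis (TotalPath V) k (PathCoalgebra k V) :=
  Module.Basis.ofRepr (LinearEquiv.refl k (TotalPath V →₀ k))

/-- A path, as an element of the path coalgebra. -/
noncomputable def path {a b : V} (p : Quiver.Path a b) : PathCoalgebra k V :=
  basis k (TotalPath.of p)

/-- A vertex (a path of length zero), as an element of the path coalgebra. -/
noncomputable def vertex (a : V) : PathCoalgebra k V :=
  path k (Quiver.Path.nil : Quiver.Path a a)

/-- `Δ(p) = ∑ later ⊗ earlier`, over all splits `p = later · earlier`;
`ε(p) = 1` if `p` is a vertex and `ε(p) = 0` otherwise. -/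
noncomputable instance : CoalgebraStruct k (PathCoalgebra k V) where
  comul := (basis k).constr k fun p =>
    ((pathSplits p.2.2).map fun s => path k s.later ⊗ₜ[k] path k s.earlier).sum
  counit := (basis k).constr k fun p => if p.length = 0 then 1 else 0

theorem comul_path {a b : V} (p : Quiver.Path a b) :
    Coalgebra.comul (R := k) (path k p) =
      ((pathSplits p).map fun s => path k s.later ⊗ₜ[k] path k s.earlier).sum :=
  Module.Basis.constr_basis ..

theorem counit_path {a b : V} (p : Quiver.Path a b) :
    Coalgebra.counit (R := k) (path k p) = if p.length = 0 then 1 else 0 :=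
  Module.Basis.constr_basis ..

theorem splits_assoc {M : Type*} [AddCommMonoid M] {a b : V} (p : Quiver.Path a b)
    (F : ∀ c d : V, Quiver.Path d b → Quiver.Path c d → Quiver.Path a c → M) :
    ((pathSplits p).map fun s =>
        ((pathSplits s.later).map fun t => F s.mid t.mid t.later t.earlier s.earlier).sum).sum =
      ((pathSplits p).map fun s =>
        ((pathSplits s.earlier).map fun t => F t.mid s.mid s.later t.later t.earlier).sum).sum := by
  induction p with
  | nil => simp [pathSplits]
  | @cons b c p e ih =>
    simp only [pathSplits, List.map_cons, List.sum_cons, List.map_map, List.map_nil, List.sum_nil,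
      Function.comp_def, List.sum_map_add, add_zero]
    rw [ih fun x y q r t => F x y (q.cons e) r t]
    simp only [add_assoc]

theorem splits_left {M : Type*} [AddCommMonoid M] {a b : V} (p : Quiver.Path a b)
    (F : ∀ c : V, Quiver.Path c b → Quiver.Path a c → M) :
    ((pathSplits p).map fun s =>
      if s.later.length = 0 then F s.mid s.later s.earlier else 0).sum = F b .nil p := by
  cases p with
  | nil => simp [pathSplits]
  | cons p e => simp [pathSplits, Function.comp_def]

theorem splits_right {M : Type*} [AddCommMonoid M] {a b : V} (p : Quiver.Path a b)
    (F : ∀ c : V, Quiver.Path c b → Quiver.Path a c → M) :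
    ((pathSplits p).map fun s =>
      if s.earlier.length = 0 then F s.mid s.later s.earlier else 0).sum = F a p .nil := by
  induction p with
  | nil => simp [pathSplits]
  | @cons b c p e ih =>
    simp only [pathSplits, List.map_cons, List.sum_cons, List.map_map, Function.comp_def]
    rw [ih fun x q r => F x (q.cons e) r]
    simp

theorem hom_ext {M : Type*} [AddCommMonoid M] [Module k M] {f g : PathCoalgebra k V →ₗ[k] M}
    (h : ∀ (a b : V) (p : Quiver.Path a b), f (path k p) = g (path k p)) : f = g :=
  (basis k).ext fun p => h p.1 p.2.1 p.2.2

/-- The path coalgebra. -/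
noncomputable instance : Coalgebra k (PathCoalgebra k V) where
  coassoc := by
    refine hom_ext k fun a b p => ?_
    simp only [LinearMap.comp_apply, comul_path, map_list_sum, List.map_map, Function.comp_def,
      LinearMap.rTensor_tmul, LinearMap.lTensor_tmul, LinearEquiv.coe_coe]
    have h1 : ∀ s : PathSplit a b,
        (((pathSplits s.later).map fun t =>
          path k t.later ⊗ₜ[k] path k t.earlier).sum) ⊗ₜ[k] path k s.earlier =
        ((pathSplits s.later).map fun t =>
          (path k t.later ⊗ₜ[k] path k t.earlier) ⊗ₜ[k] path k s.earlier).sum := fun s => by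
      have := map_list_sum ((TensorProduct.mk k _ _).flip (path k s.earlier))
        ((pathSplits s.later).map fun t => path k t.later ⊗ₜ[k] path k t.earlier)
      simpa [List.map_map, Function.comp_def] using this
    have h2 : ∀ s : PathSplit a b,
        path k s.later ⊗ₜ[k] (((pathSplits s.earlier).map fun t =>
          path k t.later ⊗ₜ[k] path k t.earlier).sum) =
        ((pathSplits s.earlier).map fun t =>
          path k s.later ⊗ₜ[k] (path k t.later ⊗ₜ[k] path k t.earlier)).sum := fun s => by
      have := map_list_sum (TensorProduct.mk k _ _ (path k s.later))
        ((pathSplits s.earlier).map fun t => path k t.later ⊗ₜ[k] path k t.earlier)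
      simpa [List.map_map, Function.comp_def] using this
    simp only [h1, h2, map_list_sum, List.map_map, Function.comp_def, TensorProduct.assoc_tmul]
    exact splits_assoc p fun c d x y z => path k x ⊗ₜ[k] (path k y ⊗ₜ[k] path k z)
  rTensor_counit_comp_comul := by
    refine hom_ext k fun a b p => ?_
    simp only [LinearMap.comp_apply, comul_path, map_list_sum, List.map_map, Function.comp_def,
      LinearMap.rTensor_tmul, counit_path, TensorProduct.ite_tmul, TensorProduct.mk_apply]
    simpa using splits_left p fun _ _ y => (1 : k) ⊗ₜ[k] path k y
  lTensor_counit_comp_comul := by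
    refine hom_ext k fun a b p => ?_
    simp only [LinearMap.comp_apply, comul_path, map_list_sum, List.map_map, Function.comp_def,
      LinearMap.lTensor_tmul, counit_path, TensorProduct.tmul_ite, LinearMap.flip_apply,
      TensorProduct.mk_apply]
    simpa using splits_right p fun _ x _ => path k x ⊗ₜ[k] (1 : k)

/-- The length grading: `degree k V n` is the span of the paths of length `n`. -/
noncomputable def degree (k : Type w) [Field k] (V : Type u) [Quiver.{v} V] (n : ℕ) :
    Submodule k (PathCoalgebra k V) :=
  Submodule.span k {x | ∃ (a b : V) (p : Quiver.Path a b), p.length = n ∧ x = path k p}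

end PathCoalgebra

/-! ### Graded coquasitriangular Hopf structures on a coalgebra -/

section HopfStructures

variable (k : Type u) [Field k] (A : Type v) [AddCommGroup A] [Module k A] [Coalgebra k A]

/-- A Hopf algebra structure on a given coalgebra `A`: a unital associative product which is a
morphism of coalgebras (as is the unit), and an antipode. -/
structure HopfStructure where
  /-- The multiplication, a morphism of coalgebras. -/
  mul : A ⊗[k] A →ₗc[k] A
  /-- The unit element. -/
  one : A
  mul_assoc : ∀ a b c : A, mul (mul (a ⊗ₜ b) ⊗ₜ c) = mul (a ⊗ₜ mul (b ⊗ₜ c))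
  one_mul : ∀ a : A, mul (one ⊗ₜ a) = a
  mul_one : ∀ a : A, mul (a ⊗ₜ one) = a
  comul_one : Coalgebra.comul (R := k) one = one ⊗ₜ one
  counit_one : Coalgebra.counit (R := k) one = 1
  /-- The antipode. -/
  antipode : A →ₗ[k] A
  mul_antipode_left : ∀ a : A,
    mul (TensorProduct.map antipode LinearMap.id (Coalgebra.comul (R := k) a)) =
      Coalgebra.counit (R := k) a • one
  mul_antipode_right : ∀ a : A,
    mul (TensorProduct.map LinearMap.id antipode (Coalgebra.comul (R := k) a)) =
      Coalgebra.counit (R := k) a • one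

variable {k A}

namespace HopfStructure

variable (H : HopfStructure k A)

/-- The ring underlying a Hopf structure. -/
@[reducible] noncomputable def ring : Ring A :=
  { (inferInstance : AddCommGroup A) with
    mul := fun a b => H.mul (a ⊗ₜ b)
    one := H.one
    mul_assoc := H.mul_assoc
    one_mul := H.one_mul
    mul_one := H.mul_one
    left_distrib := fun a b c => by
      change H.mul (a ⊗ₜ (b + c)) = H.mul (a ⊗ₜ b) + H.mul (a ⊗ₜ c)
      rw [TensorProduct.tmul_add, map_add]
    right_distrib := fun a b c => by
      change H.mul ((a + b) ⊗ₜ c) = H.mul (a ⊗ₜ c) + H.mul (b ⊗ₜ c)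
      rw [TensorProduct.add_tmul, map_add]
    zero_mul := fun a => by
      change H.mul (0 ⊗ₜ a) = 0
      rw [TensorProduct.zero_tmul, map_zero]
    mul_zero := fun a => by
      change H.mul (a ⊗ₜ 0) = 0
      rw [TensorProduct.tmul_zero, map_zero] }

/-- The algebra underlying a Hopf structure. -/
@[reducible] noncomputable def algebra : letI := H.ring; Algebra k A :=
  letI := H.ring
  Algebra.ofModule
    (fun r x y => by
      change H.mul ((r • x) ⊗ₜ y) = r • H.mul (x ⊗ₜ y)
      rw [← TensorProduct.smul_tmul', map_smul])
    (fun r x y => by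
      change H.mul (x ⊗ₜ (r • y)) = r • H.mul (x ⊗ₜ y)
      rw [TensorProduct.tmul_smul, map_smul])

theorem map_mul_tensorTensorTensorComm {B : Type v} [Ring B] [Algebra k B]
    (m : B ⊗[k] B →ₗ[k] B) (hm : ∀ a b : B, m (a ⊗ₜ b) = a * b) (x y : B ⊗[k] B) :
    TensorProduct.map m m
      (TensorProduct.AlgebraTensorModule.tensorTensorTensorComm k k k k B B B B (x ⊗ₜ y)) =
      x * y := by
  have h : TensorProduct.curry (TensorProduct.map m m ∘ₗ
      (TensorProduct.AlgebraTensorModule.tensorTensorTensorComm k k k k B B B B).toLinearMap) =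
      LinearMap.mul k (B ⊗[k] B) := by
    ext a b c d
    simp [hm]
  exact LinearMap.congr_fun (LinearMap.congr_fun h x) y

theorem apply_eq_mul' {B : Type v} [Ring B] [Algebra k B]
    (m : B ⊗[k] B →ₗ[k] B) (hm : ∀ a b : B, m (a ⊗ₜ b) = a * b) (x : B ⊗[k] B) :
    m x = LinearMap.mul' k B x := by
  have h : m = LinearMap.mul' k B := by
    ext a b
    simp [hm]
  rw [h]

/-- A Hopf structure makes `A` a Hopf algebra in Mathlib's sense, over the given coalgebra. -/
@[reducible] noncomputable def hopfAlgebra : letI := H.ring; HopfAlgebra k A :=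
  letI := H.ring
  letI := H.algebra
  letI : Bialgebra k A := Bialgebra.mk' k A H.counit_one
    (fun {a b} => by
      change Coalgebra.counit (R := k) (H.mul (a ⊗ₜ b)) = _
      rw [CoalgHomClass.counit_comp_apply, TensorProduct.counit_tmul, smul_eq_mul, mul_comm])
    H.comul_one
    (fun {a b} => by
      change Coalgebra.comul (R := k) (H.mul (a ⊗ₜ b)) = _
      rw [← CoalgHomClass.map_comp_comul_apply, TensorProduct.comul_tmul]
      exact map_mul_tensorTensorTensorComm (B := A) (H.mul : A ⊗[k] A →ₗ[k] A)
        (fun _ _ => rfl) _ _)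
  { antipode := H.antipode
    mul_antipode_rTensor_comul := by
      refine LinearMap.ext fun a => ?_
      refine Eq.trans ?_ ((H.mul_antipode_left a).trans (Algebra.algebraMap_eq_smul_one _).symm)
      exact (apply_eq_mul' (B := A) (H.mul : A ⊗[k] A →ₗ[k] A) (fun _ _ => rfl) _).symm
    mul_antipode_lTensor_comul := by
      refine LinearMap.ext fun a => ?_
      refine Eq.trans ?_ ((H.mul_antipode_right a).trans (Algebra.algebraMap_eq_smul_one _).symm)
      exact (apply_eq_mul' (B := A) (H.mul : A ⊗[k] A →ₗ[k] A) (fun _ _ => rfl) _).symm }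

end HopfStructure

/-- `𝓡` is a universal `R`-form (coquasitriangular structure) of the Hopf algebra `H`. -/
structure IsUniversalRForm (H : HopfStructure k A) (𝓡 : A ⊗[k] A →ₗ[k] k) : Prop where
  /-- `𝓡` is invertible for the convolution product of linear forms on `A ⊗ A`. -/
  isUnit : IsUnit (WithConv.toConv 𝓡)
  /-- `𝓡(ab, c) = 𝓡(a, c₁) 𝓡(b, c₂)` -/
  mul_left : ∀ a b c : A, 𝓡 (H.mul (a ⊗ₜ b) ⊗ₜ c) =
    LinearMap.mul' k k (TensorProduct.map (TensorProduct.curry 𝓡 a) (TensorProduct.curry 𝓡 b)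
      (Coalgebra.comul (R := k) c))
  /-- `𝓡(a, bc) = 𝓡(a₁, c) 𝓡(a₂, b)` -/
  mul_right : ∀ a b c : A, 𝓡 (a ⊗ₜ H.mul (b ⊗ₜ c)) =
    LinearMap.mul' k k (TensorProduct.map ((TensorProduct.curry 𝓡).flip c)
      ((TensorProduct.curry 𝓡).flip b) (Coalgebra.comul (R := k) a))
  /-- `b₁ a₁ 𝓡(a₂, b₂) = 𝓡(a₁, b₁) a₂ b₂`, where
  `Δ(a ⊗ b) = (a₁ ⊗ b₁) ⊗ (a₂ ⊗ b₂)` in the tensor product coalgebra `A ⊗ A`. -/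
  comm : ∀ a b : A,
    TensorProduct.rid k A (TensorProduct.map
      ((H.mul : A ⊗[k] A →ₗ[k] A) ∘ₗ (TensorProduct.comm k A A).toLinearMap) 𝓡
      (Coalgebra.comul (R := k) (a ⊗ₜ[k] b))) =
    TensorProduct.lid k A (TensorProduct.map 𝓡 (H.mul : A ⊗[k] A →ₗ[k] A)
      (Coalgebra.comul (R := k) (a ⊗ₜ[k] b)))

/-- A graded coquasitriangular Hopf algebra structure on a coalgebra `A` with grading `𝒜`. -/
structure GradedCoquasitriangularStructure (𝒜 : ℕ → Submodule k A) extends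
    HopfStructure k A where
  mul_mem : ∀ (m n : ℕ) (a b : A), a ∈ 𝒜 m → b ∈ 𝒜 n → mul (a ⊗ₜ b) ∈ 𝒜 (m + n)
  one_mem : one ∈ 𝒜 0
  antipode_mem : ∀ (n : ℕ) (a : A), a ∈ 𝒜 n → antipode a ∈ 𝒜 n
  /-- The universal `R`-form. -/
  rForm : A ⊗[k] A →ₗ[k] k
  isUniversalRForm : IsUniversalRForm toHopfStructure rForm

/-- `𝓡` concentrates at degree `0`: `𝓡(x, y) = 0` for homogeneous `x`, `y`, unless both have
degree `0`. -/
def GradedCoquasitriangularStructure.IsConcentratedInDegreeZero {𝒜 : ℕ → Submodule k A}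
    (S : GradedCoquasitriangularStructure 𝒜) : Prop :=
  ∀ (m n : ℕ) (x y : A), x ∈ 𝒜 m → y ∈ 𝒜 n → ¬(m = 0 ∧ n = 0) → S.rForm (x ⊗ₜ y) = 0

end HopfStructures

/-! ### Hopf quivers -/

section HopfQuivers

variable {G : Type u} [Group G]

/-- The vertices of the Hopf quiver `Q(G, R)` of a ramification datum
`R = ∑ R_C C` (a family of natural numbers indexed by the conjugacy classes of `G`). -/
@[nolint unusedArguments]
def HopfQuiver (_R : ConjClasses G → ℕ) : Type u := G

/-- The vertex of `Q(G, R)` given by an element of `G`. -/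
def HopfQuiver.ofGroup (R : ConjClasses G → ℕ) (g : G) : HopfQuiver R := g

/-- There are `R_C` arrows from `x` to `y = c x`, where `C` is the class of `c = y x⁻¹`. -/
instance (R : ConjClasses G → ℕ) : Quiver.{0} (HopfQuiver R) where
  Hom x y := Fin (R (ConjClasses.mk ((show G from y) * (show G from x)⁻¹)))

/-- A quiver is connected if it is non-empty and any two vertices are joined by a path in the
underlying undirected graph. -/
def IsConnectedQuiver (V : Type u) [Quiver.{v} V] : Prop :=
  Nonempty V ∧ ∀ x y : V, Quiver.WeaklyConnectedComponent.mk x = Quiver.WeaklyConnectedComponent.mk y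

variable (k : Type v) [Field k] (R : ConjClasses G → ℕ)

/-- The graded coquasitriangular Hopf algebra structures on the path coalgebra of `Q(G, R)`. -/
abbrev HopfQuiver.CQTStructure : Type (max u v) :=
  GradedCoquasitriangularStructure (PathCoalgebra.degree k (HopfQuiver R))

/-- `g`, as a vertex of `Q(G, R)` and an element of the path coalgebra. -/
noncomputable def HopfQuiver.groupVertex (g : G) : PathCoalgebra k (HopfQuiver R) :=
  PathCoalgebra.vertex k (HopfQuiver.ofGroup R g)

/-- `Q₀ = G` as groups: the product of two vertices is their product in `G`. -/
def HopfQuiver.HasVertexGroup {k : Type v} [Field k] {R : ConjClasses G → ℕ}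
    (S : HopfQuiver.CQTStructure k R) : Prop :=
  ∀ g h : G, S.mul (HopfQuiver.groupVertex k R g ⊗ₜ HopfQuiver.groupVertex k R h) =
    HopfQuiver.groupVertex k R (g * h)

/-- `Q(G, R)` is a coquasitriangular Hopf quiver: the path coalgebra admits a graded
coquasitriangular Hopf algebra structure with `Q₀ = G`. -/
def HopfQuiver.IsCoquasitriangular : Prop :=
  ∃ S : HopfQuiver.CQTStructure k R, HopfQuiver.HasVertexGroup S

/-- The graded coquasitriangular Hopf algebra structures `(kQ, 𝓡)` on the path coalgebra of
`Q = Q(G, R)` with `Q₀ = G` and `𝓡` concentrated at degree `0`. -/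
def HopfQuiver.DegreeZeroStructure : Type (max u v) :=
  {S : HopfQuiver.CQTStructure k R //
    HopfQuiver.HasVertexGroup S ∧ S.IsConcentratedInDegreeZero}

variable {k R}

/-- Two structures are isomorphic if there is an isomorphism of graded coquasitriangular Hopf
algebras between them which is the identity on `Q₀ = G`. -/
def HopfQuiver.DegreeZeroStructure.Iso (S T : HopfQuiver.DegreeZeroStructure k R) : Prop :=
  ∃ φ : PathCoalgebra k (HopfQuiver R) ≃ₗc[k] PathCoalgebra k (HopfQuiver R),
    (∀ x y, φ (S.1.mul (x ⊗ₜ y)) = T.1.mul (φ x ⊗ₜ φ y)) ∧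
    φ S.1.one = T.1.one ∧
    (∀ x, φ (S.1.antipode x) = T.1.antipode (φ x)) ∧
    (∀ (n : ℕ) (x), x ∈ PathCoalgebra.degree k (HopfQuiver R) n →
      φ x ∈ PathCoalgebra.degree k (HopfQuiver R) n) ∧
    (∀ x y, T.1.rForm (φ x ⊗ₜ φ y) = S.1.rForm (x ⊗ₜ y)) ∧
    ∀ g : G, φ (HopfQuiver.groupVertex k R g) = HopfQuiver.groupVertex k R g

/-- A skew-symmetric bicharacter of `G` with values in `k`. -/
@[ext] structure SkewSymmetricBicharacter (k : Type v) [Field k] (G : Type u) [Group G] where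
  /-- The underlying function. -/
  toFun : G → G → k
  map_mul_right : ∀ f g h : G, toFun f (g * h) = toFun f g * toFun f h
  map_mul_left : ∀ f g h : G, toFun (f * g) h = toFun f h * toFun g h
  map_one_right : ∀ f : G, toFun f 1 = 1
  map_one_left : ∀ f : G, toFun 1 f = 1
  skew : ∀ g h : G, toFun g h * toFun h g = 1

end HopfQuivers

/-! The path coalgebra is cofree over its vertices and arrows: the coefficient of a path in `x` can
be read off arrow by arrow from the coproduct (`coeff_cons`). A coalgebra morphism into it is
therefore known from its vertex and arrow coefficients, and a graded one from its values in total
degree at most one (`hom_eq_of_eq_on_arrows`, `hom_tensor_eq_of_eq_on_arrows`). So a graded product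
is fixed by the left and right actions of `G` on the spans of arrows, and identities between
products need checking only when one factor is an arrow or a vertex and all others are vertices.

Let `𝓡` be concentrated in degree 0. On vertices the first two axioms make it multiplicative,
convolution invertibility makes it nonzero, and the third axiom makes `G` abelian. For an arrow `w :
a ⟶ b` the third axiom reads `𝓡(a,g) g·w = 𝓡(b,g) w·g` and, with the factors swapped, `𝓡(g,a) w·g =
𝓡(g,b) g·w`. Hence `𝓡(a,g) 𝓡(g,a)` takes the same value at both ends of an arrow, and connectedness
spreads the value 1 from the vertex 1 (`form_mul_form_swap`).

Injectivity: the first relation determines the right action from the left action and `𝓡`. Any two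
left actions are equivalent: translate an arrow back to source 1 with one structure and forward
again with the other. This substitution extends to a coalgebra automorphism (`gauge`), which
respects the whole structure (`iso_of_form_eq`).

Surjectivity: for a given `β`, let `G` act on arrows from the left by translation and from the right
by translation times `β(a,g) β(g,b)`, as the relation demands. The product is the resulting quantum
shuffle product (`mulPath`), the form is `β` extended by zero. Skew symmetry yields associativity
and the convolution inverse; the assumed structure supplies the commutativity of `G` behind the
third axiom (`shuffleStructure`). -/

namespace PathCoalgebra

/-! ### Coefficients of paths and cofreeness -/

section Path

variable {k : Type w} [Field k] {V : Type u} [Quiver.{v} V]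

theorem vertex_eq_path (a : V) :
    vertex k a = path k (Quiver.Path.nil : Quiver.Path a a) := rfl

theorem path_ne_zero {a b : V} (p : Quiver.Path a b) : path k p ≠ 0 :=
  (basis k).ne_zero _

theorem path_mem_degree {a b : V} (p : Quiver.Path a b) {n : ℕ} (h : p.length = n) :
    path k p ∈ degree k V n :=
  Submodule.subset_span ⟨a, b, p, h, rfl⟩

theorem vertex_mem_degree (a : V) : vertex k a ∈ degree k V 0 :=
  path_mem_degree _ rfl

theorem comul_vertex (a : V) :
    Coalgebra.comul (R := k) (vertex k a) = vertex k a ⊗ₜ[k] vertex k a := by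
  rw [vertex, comul_path]; simp [pathSplits]

theorem counit_vertex (a : V) : Coalgebra.counit (R := k) (vertex k a) = 1 := by
  rw [vertex, counit_path]; simp

theorem comul_toPath {a b : V} (e : a ⟶ b) :
    Coalgebra.comul (R := k) (path k e.toPath) =
      vertex k b ⊗ₜ[k] path k e.toPath + path k e.toPath ⊗ₜ[k] vertex k a := by
  rw [comul_path]; simp [pathSplits, Quiver.Hom.toPath, vertex]

theorem induction_on {motive : PathCoalgebra k V → Prop}
    (path : ∀ (a b : V) (p : Quiver.Path a b), motive (path k p)) (zero : motive 0)
    (add : ∀ x y, motive x → motive y → motive (x + y))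
    (smul : ∀ (c : k) x, motive x → motive (c • x)) (x : PathCoalgebra k V) : motive x := by
  have hx : x ∈ Submodule.span k (Set.range (basis k (V := V))) := by
    rw [(basis k).span_eq]; trivial
  induction hx using Submodule.span_induction with
  | mem x h => obtain ⟨p, rfl⟩ := h; exact path p.1 p.2.1 p.2.2
  | zero => exact zero
  | add x y _ _ hx hy => exact add x y hx hy
  | smul c x _ hx => exact smul c x hx

theorem of_cons_eq_of_cons {a b c a' b' c' : V} (p : Quiver.Path a b) (e : b ⟶ c)
    (p' : Quiver.Path a' b') (e' : b' ⟶ c') :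
    TotalPath.of (p.cons e) = TotalPath.of (p'.cons e') ↔
      TotalPath.of e.toPath = TotalPath.of e'.toPath ∧ TotalPath.of p = TotalPath.of p' := by
  constructor
  · intro h
    obtain ⟨rfl, h⟩ := Sigma.mk.inj_iff.1 h
    obtain ⟨rfl, h⟩ := Sigma.mk.inj_iff.1 (eq_of_heq h)
    cases eq_of_heq h
    exact ⟨rfl, rfl⟩
  · rintro ⟨h, h'⟩
    obtain ⟨rfl, h⟩ := Sigma.mk.inj_iff.1 h
    obtain ⟨rfl, h⟩ := Sigma.mk.inj_iff.1 (eq_of_heq h)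
    cases eq_of_heq h
    obtain ⟨rfl, h'⟩ := Sigma.mk.inj_iff.1 h'
    obtain ⟨_, h'⟩ := Sigma.mk.inj_iff.1 (eq_of_heq h')
    cases eq_of_heq h'
    rfl

/-- The coefficient of a path. -/
noncomputable def coeff (p : TotalPath V) : PathCoalgebra k V →ₗ[k] k := (basis k).coord p

open Classical in
theorem coeff_path (q : TotalPath V) {a b : V} (p : Quiver.Path a b) :
    coeff q (path k p) = if TotalPath.of p = q then 1 else 0 := by
  rw [coeff, path, Module.Basis.coord_apply, Module.Basis.repr_self, Finsupp.single_apply]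

theorem ext_coeff {x y : PathCoalgebra k V} (h : ∀ p, coeff p x = coeff p y) : x = y :=
  (basis k).ext_elem h

theorem coeff_of_mem_degree {n : ℕ} {x : PathCoalgebra k V} (hx : x ∈ degree k V n)
    {p : TotalPath V} (hp : p.length ≠ n) : coeff p x = 0 := by
  induction hx using Submodule.span_induction with
  | mem x h =>
    obtain ⟨a, b, q, hq, rfl⟩ := h
    classical
    rw [coeff_path, if_neg]
    rintro rfl
    exact hp hq
  | zero => simp
  | add x y _ _ hx hy => simp [hx, hy]
  | smul c x _ hx => simp [hx]

/-- A path of positive length has exactly one split whose terminal piece is an arrow, so the two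
coefficient functionals pick a single term out of the coproduct. This recursion is cofreeness in
coordinates. -/
theorem coeff_cons {a b c : V} (q : Quiver.Path a b) (e : b ⟶ c) (x : PathCoalgebra k V) :
    coeff (TotalPath.of (q.cons e)) x =
      LinearMap.mul' k k (TensorProduct.map (coeff (TotalPath.of e.toPath))
        (coeff (TotalPath.of q)) (Coalgebra.comul (R := k) x)) := by
  classical
  suffices h : coeff (k := k) (TotalPath.of (q.cons e)) = LinearMap.mul' k k ∘ₗ
      TensorProduct.map (coeff (TotalPath.of e.toPath)) (coeff (TotalPath.of q)) ∘ₗ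
        Coalgebra.comul from LinearMap.congr_fun h x
  refine hom_ext k fun a' c' p => ?_
  simp only [LinearMap.comp_apply, comul_path, map_list_sum, List.map_map, Function.comp_def,
    TensorProduct.map_tmul, LinearMap.mul'_apply, coeff_path]
  cases p with
  | nil =>
    rw [if_neg fun h => ?_]
    · simp only [pathSplits, List.map_cons, List.map_nil, List.sum_cons, List.sum_nil]
      rw [if_neg fun h => ?_]
      · simp
      · simpa [TotalPath.length, TotalPath.of] using congrArg TotalPath.length h
    · simpa [TotalPath.length, TotalPath.of] using congrArg TotalPath.length h
  | @cons b' _ p' e' =>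
    simp only [pathSplits, List.map_cons, List.map_map, List.sum_cons, Function.comp_def]
    rw [if_neg (c := TotalPath.of Quiver.Path.nil = _) fun h => ?_]
    -- With the last arrow `e'` set aside, the terminal piece is a single arrow exactly when what
    -- remains of it is trivial; `splits_left` isolates that split.
    · have := splits_left p' fun d (l : Quiver.Path d b') (r : Quiver.Path a' d) =>
        (if TotalPath.of (l.cons e') = TotalPath.of e.toPath then (1 : k) else 0) *
          if TotalPath.of r = TotalPath.of q then 1 else 0
      rw [zero_mul, zero_add]
      refine Eq.trans ?_ (this.symm.trans ?_)
      · rw [if_congr (of_cons_eq_of_cons p' e' q e) rfl rfl, ite_and,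
          ite_mul, one_mul, zero_mul]
        rfl
      · congr 2
        funext s
        by_cases hs : s.later.length = 0
        · rw [if_pos hs]
        · rw [if_neg hs, if_neg fun h2 => ?_, zero_mul]
          refine absurd (congrArg TotalPath.length h2) ?_
          simpa [TotalPath.length, TotalPath.of, Quiver.Hom.toPath] using hs
    · simpa [TotalPath.length, TotalPath.of, Quiver.Hom.toPath] using congrArg TotalPath.length h

/-- A morphism of coalgebras into the path coalgebra is determined by the coefficients of the
vertices and of the arrows. -/
theorem eq_of_coeff_eq {C : Type*} [AddCommGroup C] [Module k C] [CoalgebraStruct k C]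
    {F F' : C →ₗc[k] PathCoalgebra k V}
    (h : ∀ p : TotalPath V, p.length ≤ 1 → ∀ x, coeff p (F x) = coeff p (F' x)) : F = F' := by
  -- `coeff_cons` pulled back along a morphism: the coefficient functional of a longer path is a
  -- convolution of those of its last arrow and of the rest.
  have step : ∀ (E : C →ₗc[k] PathCoalgebra k V) {a b c : V} (q : Quiver.Path a b) (e : b ⟶ c),
      coeff (TotalPath.of (q.cons e)) ∘ₗ E.toLinearMap = LinearMap.mul' k k ∘ₗ
        TensorProduct.map (coeff (TotalPath.of e.toPath) ∘ₗ E.toLinearMap)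
          (coeff (TotalPath.of q) ∘ₗ E.toLinearMap) ∘ₗ Coalgebra.comul := by
    intro E a b c q e
    rw [TensorProduct.map_comp, LinearMap.comp_assoc, E.map_comp_comul]
    exact LinearMap.ext fun x => coeff_cons q e (E x)
  suffices key : ∀ (a b : V) (p : Quiver.Path a b),
      coeff (TotalPath.of p) ∘ₗ F.toLinearMap = coeff (TotalPath.of p) ∘ₗ F'.toLinearMap from
    CoalgHom.ext fun x => ext_coeff fun p => LinearMap.congr_fun (key p.1 p.2.1 p.2.2) x
  intro a b p
  induction p with
  | nil => exact LinearMap.ext (h _ (Nat.zero_le _))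
  | cons q e ih =>
    have he : coeff (TotalPath.of e.toPath) ∘ₗ F.toLinearMap =
        coeff (TotalPath.of e.toPath) ∘ₗ F'.toLinearMap :=
      LinearMap.ext (h (TotalPath.of e.toPath) le_rfl)
    rw [step F, step F', ih, he]

/-! ### Appending an arrow -/

section Cons

variable {a b c : V}

open Classical in
/-- Appending an arrow to a path; paths with the wrong end point go to zero. -/
noncomputable def consL (e : b ⟶ c) : PathCoalgebra k V →ₗ[k] PathCoalgebra k V :=
  (basis k).constr k fun p => if h : p.2.1 = b then path k ((h ▸ p.2.2).cons e) else 0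

theorem consL_path (e : b ⟶ c) (p : Quiver.Path a b) :
    consL e (path k p) = path k (p.cons e) := by
  rw [consL, path, Module.Basis.constr_basis]
  simp [TotalPath.of]

theorem consL_path_of_ne (e : b ⟶ c) {b' : V} (p : Quiver.Path a b') (h : b' ≠ b) :
    consL e (path k p) = 0 := by
  rw [consL, path, Module.Basis.constr_basis]
  exact dif_neg h

theorem consL_vertex (e : b ⟶ c) : consL e (vertex k b) = path k e.toPath :=
  consL_path e _

/-- The split with trivial terminal piece is the extra term; all others extend the terminal piece of
a split of `x`. Terminal pieces end where the path ends, so for a wrong end point both sides vanish.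
-/
theorem comul_consL (e : b ⟶ c) (x : PathCoalgebra k V) :
    Coalgebra.comul (R := k) (consL e x) =
      vertex k c ⊗ₜ[k] consL e x +
        (consL e).rTensor (PathCoalgebra k V) (Coalgebra.comul (R := k) x) := by
  induction x using induction_on with
  | path a b' p =>
    by_cases h : b' = b
    · subst h
      rw [consL_path, comul_path, comul_path]
      simp [pathSplits, map_list_sum, Function.comp_def, consL_path, vertex]
    · rw [consL_path_of_ne e p h, comul_path]
      simp [map_list_sum, Function.comp_def, consL_path_of_ne e _ h]
  | zero => simp
  | add x y hx hy => simp only [map_add, hx, hy, TensorProduct.tmul_add]; abel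
  | smul r x hx => simp only [map_smul, hx, TensorProduct.tmul_smul, smul_add]

theorem counit_consL (e : b ⟶ c) (x : PathCoalgebra k V) :
    Coalgebra.counit (R := k) (consL e x) = 0 := by
  induction x using induction_on with
  | path a b' p =>
    by_cases h : b' = b
    · subst h
      rw [consL_path, counit_path]
      simp
    · rw [consL_path_of_ne e p h, map_zero]
  | zero => simp
  | add x y hx hy => simp only [map_add, hx, hy, add_zero]
  | smul r x hx => simp only [map_smul, hx, smul_zero]

theorem consL_mem_degree (e : b ⟶ c) {n : ℕ} {x : PathCoalgebra k V}
    (hx : x ∈ degree k V n) : consL e x ∈ degree k V (n + 1) := by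
  induction hx using Submodule.span_induction with
  | mem x h =>
    obtain ⟨a, b', p, hp, rfl⟩ := h
    by_cases h : b' = b
    · subst h
      rw [consL_path]
      exact path_mem_degree _ (by simp [hp])
    · rw [consL_path_of_ne e p h]
      exact zero_mem _
  | zero => simp
  | add x y _ _ hx hy => rw [map_add]; exact add_mem hx hy
  | smul r x _ hx => rw [map_smul]; exact Submodule.smul_mem _ _ hx

end Cons

/-! ### Graded morphisms are determined in degrees at most one -/

theorem map_mem_of_path {M : Type*} [AddCommGroup M] [Module k M]
    {F : PathCoalgebra k V →ₗ[k] M} {N : ℕ → Submodule k M}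
    (h : ∀ (a b : V) (p : Quiver.Path a b), F (path k p) ∈ N p.length)
    (n : ℕ) (x : PathCoalgebra k V) (hx : x ∈ degree k V n) : F x ∈ N n := by
  induction hx using Submodule.span_induction with
  | mem x hx => obtain ⟨a, b, p, rfl, rfl⟩ := hx; exact h a b p
  | zero => simp
  | add x y _ _ hx hy => rw [map_add]; exact add_mem hx hy
  | smul r x _ hx => rw [map_smul]; exact Submodule.smul_mem _ _ hx

/-- A graded morphism of coalgebras between path coalgebras is determined by its values on vertices
and arrows. -/
theorem hom_eq_of_eq_on_arrows {F F' : PathCoalgebra k V →ₗc[k] PathCoalgebra k V}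
    (dF : ∀ (a b : V) (p : Quiver.Path a b), F (path k p) ∈ degree k V p.length)
    (dF' : ∀ (a b : V) (p : Quiver.Path a b), F' (path k p) ∈ degree k V p.length)
    (h : ∀ a b : V, ∀ p : Quiver.Path a b, p.length ≤ 1 → F (path k p) = F' (path k p)) :
    F = F' := by
  refine eq_of_coeff_eq fun q hq => LinearMap.congr_fun (f := coeff q ∘ₗ F.toLinearMap)
    (g := coeff q ∘ₗ F'.toLinearMap) (hom_ext k fun a b p => ?_)
  change coeff q (F (path k p)) = coeff q (F' (path k p))
  -- Above degree one both images are homogeneous of degree at least two, so their vertex and arrow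
  -- coefficients vanish.
  by_cases hp : p.length ≤ 1
  · rw [h a b p hp]
  · rw [coeff_of_mem_degree (dF a b p) (by lia),
      coeff_of_mem_degree (dF' a b p) (by lia)]

/-- A graded morphism of coalgebras from the tensor square of a path coalgebra to the path coalgebra
is determined by its values in degrees at most one. -/
theorem hom_tensor_eq_of_eq_on_arrows
    {F F' : PathCoalgebra k V ⊗[k] PathCoalgebra k V →ₗc[k] PathCoalgebra k V}
    (dF : ∀ (a b a' b' : V) (p : Quiver.Path a b) (q : Quiver.Path a' b'),
      F (path k p ⊗ₜ path k q) ∈ degree k V (p.length + q.length))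
    (dF' : ∀ (a b a' b' : V) (p : Quiver.Path a b) (q : Quiver.Path a' b'),
      F' (path k p ⊗ₜ path k q) ∈ degree k V (p.length + q.length))
    (h : ∀ (a b a' b' : V) (p : Quiver.Path a b) (q : Quiver.Path a' b'),
      p.length + q.length ≤ 1 → F (path k p ⊗ₜ path k q) = F' (path k p ⊗ₜ path k q)) :
    F = F' := by
  refine eq_of_coeff_eq fun r hr => LinearMap.congr_fun (f := coeff r ∘ₗ F.toLinearMap)
    (g := coeff r ∘ₗ F'.toLinearMap) (TensorProduct.ext <|
      hom_ext k fun a b p => hom_ext k fun a' b' q => ?_)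
  change coeff r (F (path k p ⊗ₜ path k q)) = coeff r (F' (path k p ⊗ₜ path k q))
  by_cases hp : p.length + q.length ≤ 1
  · rw [h _ _ _ _ p q hp]
  · rw [coeff_of_mem_degree (dF _ _ _ _ p q) (by lia),
      coeff_of_mem_degree (dF' _ _ _ _ p q) (by lia)]

/-- The analogue of `hom_tensor_eq_of_eq_on_arrows` for three tensor factors. -/
theorem hom_tensor_tensor_eq_of_eq_on_arrows
    {F F' : (PathCoalgebra k V ⊗[k] PathCoalgebra k V) ⊗[k] PathCoalgebra k V →ₗc[k]
      PathCoalgebra k V}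
    (dF : ∀ (a b a' b' a'' b'' : V) (p : Quiver.Path a b) (q : Quiver.Path a' b')
      (r : Quiver.Path a'' b''), F ((path k p ⊗ₜ path k q) ⊗ₜ path k r) ∈
        degree k V (p.length + q.length + r.length))
    (dF' : ∀ (a b a' b' a'' b'' : V) (p : Quiver.Path a b) (q : Quiver.Path a' b')
      (r : Quiver.Path a'' b''), F' ((path k p ⊗ₜ path k q) ⊗ₜ path k r) ∈
        degree k V (p.length + q.length + r.length))
    (h : ∀ (a b a' b' a'' b'' : V) (p : Quiver.Path a b) (q : Quiver.Path a' b')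
      (r : Quiver.Path a'' b''), p.length + q.length + r.length ≤ 1 →
        F ((path k p ⊗ₜ path k q) ⊗ₜ path k r) = F' ((path k p ⊗ₜ path k q) ⊗ₜ path k r)) :
    F = F' := by
  refine eq_of_coeff_eq fun s hs => LinearMap.congr_fun (f := coeff s ∘ₗ F.toLinearMap)
    (g := coeff s ∘ₗ F'.toLinearMap) (TensorProduct.ext <| TensorProduct.ext <|
      hom_ext k fun a b p => hom_ext k fun a' b' q => hom_ext k fun a'' b'' r => ?_)
  change coeff s (F ((path k p ⊗ₜ path k q) ⊗ₜ path k r)) =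
    coeff s (F' ((path k p ⊗ₜ path k q) ⊗ₜ path k r))
  by_cases hp : p.length + q.length + r.length ≤ 1
  · rw [h _ _ _ _ _ _ p q r hp]
  · rw [coeff_of_mem_degree (dF _ _ _ _ _ _ p q r) (by lia),
      coeff_of_mem_degree (dF' _ _ _ _ _ _ p q r) (by lia)]

/-! ### Skew-primitive elements of degree one -/

/-- The span of the arrows from `a` to `b`. -/
noncomputable def arrowSpan (k : Type w) [Field k] {V : Type u} [Quiver.{v} V] (a b : V) :
    Submodule k (PathCoalgebra k V) :=
  Submodule.span k (Set.range fun e : a ⟶ b => path k e.toPath)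

theorem toPath_mem_arrowSpan {a b : V} (e : a ⟶ b) : path k e.toPath ∈ arrowSpan k a b :=
  Submodule.subset_span ⟨e, rfl⟩

theorem arrowSpan_le_degree (a b : V) : arrowSpan k a b ≤ degree k V 1 := by
  rw [arrowSpan, Submodule.span_le]
  rintro _ ⟨e, rfl⟩
  exact path_mem_degree _ rfl

theorem comul_of_mem_arrowSpan {a b : V} {w : PathCoalgebra k V} (hw : w ∈ arrowSpan k a b) :
    Coalgebra.comul (R := k) w = vertex k b ⊗ₜ[k] w + w ⊗ₜ[k] vertex k a := by
  induction hw using Submodule.span_induction with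
  | mem x h => obtain ⟨e, rfl⟩ := h; exact comul_toPath e
  | zero => simp
  | add x y _ _ hx hy =>
    simp only [map_add, hx, hy, TensorProduct.tmul_add, TensorProduct.add_tmul]; abel
  | smul r x _ hx =>
    simp only [map_smul, hx, TensorProduct.tmul_smul, smul_add, TensorProduct.smul_tmul']

/-- Skew-primitive elements of degree one are combinations of arrows. -/
theorem mem_arrowSpan_of_comul {a b : V} {w : PathCoalgebra k V} (hw : w ∈ degree k V 1)
    (h : Coalgebra.comul (R := k) w = vertex k b ⊗ₜ[k] w + w ⊗ₜ[k] vertex k a) :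
    w ∈ arrowSpan k a b := by
  classical
  -- `T` keeps the paths ending at `b` and `S` those starting at `a`. Having degree one, `w` has no
  -- vertex coefficients, so the assumed coproduct makes both fix `w`.
  let T : PathCoalgebra k V →ₗ[k] PathCoalgebra k V :=
    (TensorProduct.lid k _).toLinearMap ∘ₗ
      (coeff (k := k) (TotalPath.of (Quiver.Path.nil : Quiver.Path b b))).rTensor _ ∘ₗ
        Coalgebra.comul
  let S : PathCoalgebra k V →ₗ[k] PathCoalgebra k V :=
    (TensorProduct.rid k _).toLinearMap ∘ₗ
      (coeff (k := k) (TotalPath.of (Quiver.Path.nil : Quiver.Path a a))).lTensor _ ∘ₗ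
        Coalgebra.comul
  have hTw : T w = w := by
    have := coeff_of_mem_degree hw (p := TotalPath.of (Quiver.Path.nil : Quiver.Path b b))
      (by simp [TotalPath.length, TotalPath.of])
    simp [T, h, this, vertex, coeff_path]
  have hSw : S w = w := by
    have := coeff_of_mem_degree hw (p := TotalPath.of (Quiver.Path.nil : Quiver.Path a a))
      (by simp [TotalPath.length, TotalPath.of])
    simp [S, h, this, vertex, coeff_path]
  have nil_eq : ∀ {c d : V}, TotalPath.of (Quiver.Path.nil : Quiver.Path c c) =
      TotalPath.of (Quiver.Path.nil : Quiver.Path d d) ↔ c = d := fun {c d} =>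
    ⟨fun h => congrArg Sigma.fst h, fun h => by subst h; rfl⟩
  have ne_nil : ∀ {c c' d : V} (e : c ⟶ c'), TotalPath.of e.toPath ≠
      TotalPath.of (Quiver.Path.nil : Quiver.Path d d) := fun e h => by
    simpa [TotalPath.length, TotalPath.of, Quiver.Hom.toPath] using congrArg TotalPath.length h
  have key : ∀ x ∈ degree k V 1, S (T x) ∈ arrowSpan k a b := by
    -- Only degree one matters, so the target is the whole space in every other degree.
    refine fun x hx => map_mem_of_path (F := S ∘ₗ T) (N := fun n => if n = 1 then
      arrowSpan k a b else ⊤) (fun c d p => ?_) 1 x hx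
    split_ifs with hp
    · match p, hp with
      | .cons .nil e, _ =>
        change (S ∘ₗ T) (path k e.toPath) ∈ _
        simp only [S, T, LinearMap.comp_apply, comul_toPath, map_add, LinearMap.rTensor_tmul,
          vertex, coeff_path, nil_eq, ne_nil, if_false, LinearEquiv.coe_coe,
          TensorProduct.lid_tmul, zero_smul, add_zero]
        split_ifs with hd
        · simp only [one_smul, comul_toPath, map_add, LinearMap.lTensor_tmul,
            vertex, coeff_path, nil_eq, ne_nil, if_false,
            TensorProduct.rid_tmul, zero_smul, zero_add]
          split_ifs with hc
          · subst hc hd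
            rw [one_smul]
            exact toPath_mem_arrowSpan e
          · rw [zero_smul]
            exact zero_mem _
        · simp
    · trivial
  have := key w hw
  rwa [hTw, hSw] at this

end Path

end PathCoalgebra

namespace PathCoalgebra

/-! ### Convolution inverses by geometric series -/

section Convolution

variable {k : Type w} [Field k] {V : Type u} [Quiver.{v} V]

theorem length_add_length_of_mem_pathSplits {a b : V} (p : Quiver.Path a b) :
    ∀ s ∈ pathSplits p, s.later.length + s.earlier.length = p.length := by
  induction p with
  | nil => simp [pathSplits]
  | cons p e ih =>
    intro s hs
    simp only [pathSplits, List.mem_cons, List.mem_map] at hs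
    rcases hs with rfl | ⟨t, ht, rfl⟩
    · simp
    · have := ih t ht
      simp only [Quiver.Path.length_cons]
      lia

theorem list_sum_mem_of_forall {R M ι : Type*} [Semiring R] [AddCommMonoid M] [Module R M]
    (S : Submodule R M) (l : List ι) (f : ι → M) (h : ∀ i ∈ l, f i ∈ S) :
    (l.map f).sum ∈ S :=
  list_sum_mem fun x hx => by
    obtain ⟨i, hi, rfl⟩ := List.mem_map.1 hx
    exact h i hi

variable {A : Type*} [Ring A] [Algebra k A]

open WithConv

theorem convMul_path (f g : WithConv (PathCoalgebra k V →ₗ[k] A)) {a b : V}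
    (p : Quiver.Path a b) : (f * g) (path k p) =
      ((pathSplits p).map fun s => f (path k s.later) * g (path k s.earlier)).sum := by
  rw [LinearMap.convMul_apply, comul_path]
  simp only [map_list_sum, List.map_map, Function.comp_def, TensorProduct.map_tmul,
    LinearMap.mul'_apply]

theorem convMul_congr_right (f : WithConv (PathCoalgebra k V →ₗ[k] A))
    {g g' : WithConv (PathCoalgebra k V →ₗ[k] A)} {a b : V} (p : Quiver.Path a b)
    (h : ∀ (c d : V) (q : Quiver.Path c d), q.length ≤ p.length → g (path k q) = g' (path k q)) :
    (f * g) (path k p) = (f * g') (path k p) := by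
  rw [convMul_path, convMul_path]
  refine congrArg List.sum (List.map_congr_left fun s hs => ?_)
  rw [h _ _ s.earlier (by have := length_add_length_of_mem_pathSplits p s hs; lia)]

theorem convMul_congr_left (f : WithConv (PathCoalgebra k V →ₗ[k] A))
    {g g' : WithConv (PathCoalgebra k V →ₗ[k] A)} {a b : V} (p : Quiver.Path a b)
    (h : ∀ (c d : V) (q : Quiver.Path c d), q.length ≤ p.length → g (path k q) = g' (path k q)) :
    (g * f) (path k p) = (g' * f) (path k p) := by
  rw [convMul_path, convMul_path]
  refine congrArg List.sum (List.map_congr_left fun s hs => ?_)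
  rw [h _ _ s.later (by have := length_add_length_of_mem_pathSplits p s hs; lia)]

/-- A nonzero term would need `n` consecutive pieces of positive length, which a path with fewer
than `n` arrows cannot provide. -/
theorem convPow_path_eq_zero {h : WithConv (PathCoalgebra k V →ₗ[k] A)}
    (h0 : ∀ (a b : V) (p : Quiver.Path a b), p.length = 0 → h (path k p) = 0) (n : ℕ) :
    ∀ {a b : V} (p : Quiver.Path a b), p.length < n → (h ^ n) (path k p) = 0 := by
  induction n with
  | zero => intro a b p hp; lia
  | succ n ih =>
    intro a b p hp
    rw [pow_succ, convMul_path]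
    refine List.sum_eq_zero fun x hx => ?_
    obtain ⟨s, hs, rfl⟩ := List.mem_map.1 hx
    have hl := length_add_length_of_mem_pathSplits p s hs
    by_cases h1 : s.earlier.length = 0
    · simp only [h0 _ _ _ h1, mul_zero]
    · simp only [ih s.later (by lia), zero_mul]

theorem convMul_path_eq_zero {f g : WithConv (PathCoalgebra k V →ₗ[k] A)} {n : ℕ}
    (hf : ∀ {a b : V} (p : Quiver.Path a b), p.length < n → f (path k p) = 0) {a b : V}
    (p : Quiver.Path a b) (hp : p.length < n) : (f * g) (path k p) = 0 := by
  rw [convMul_path]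
  refine List.sum_eq_zero fun x hx => ?_
  obtain ⟨s, hs, rfl⟩ := List.mem_map.1 hx
  have hl := length_add_length_of_mem_pathSplits p s hs
  simp only [hf s.later (by lia), zero_mul]

theorem convOne_path {a b : V} (p : Quiver.Path a b) :
    (1 : WithConv (PathCoalgebra k V →ₗ[k] A)) (path k p) = if p.length = 0 then 1 else 0 := by
  rw [LinearMap.convOne_apply, counit_path]
  split_ifs <;> simp

theorem convSub_apply (f g : WithConv (PathCoalgebra k V →ₗ[k] A)) (x : PathCoalgebra k V) :
    (f - g) x = f x - g x := rfl

theorem convSum_apply {ι : Type*} (s : Finset ι) (f : ι → WithConv (PathCoalgebra k V →ₗ[k] A))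
    (x : PathCoalgebra k V) : (∑ i ∈ s, f i) x = ∑ i ∈ s, f i x := by
  classical
  induction s using Finset.induction_on with
  | empty => simp
  | insert i s hi ih => rw [Finset.sum_insert hi, Finset.sum_insert hi, ← ih]; rfl

/-- A linear map of degree zero from a path coalgebra to a graded algebra which takes the vertices
to units is invertible for the convolution product, with an inverse of degree zero. -/
theorem exists_convInverse (f g : PathCoalgebra k V →ₗ[k] A)
    (hfg : ∀ a : V, f (vertex k a) * g (vertex k a) = 1)
    (hgf : ∀ a : V, g (vertex k a) * f (vertex k a) = 1)
    (N : ℕ → Submodule k A) (hN1 : 1 ∈ N 0)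
    (hN : ∀ m n a b, a ∈ N m → b ∈ N n → a * b ∈ N (m + n))
    (hf : ∀ (a b : V) (p : Quiver.Path a b), f (path k p) ∈ N p.length)
    (hg : ∀ (a b : V) (p : Quiver.Path a b), g (path k p) ∈ N p.length) :
    ∃ s : PathCoalgebra k V →ₗ[k] A, toConv s * toConv f = 1 ∧ toConv f * toConv s = 1 ∧
      ∀ (a b : V) (p : Quiver.Path a b), s (path k p) ∈ N p.length := by
  obtain ⟨F, hF⟩ : ∃ F : WithConv (PathCoalgebra k V →ₗ[k] A), F = toConv f := ⟨_, rfl⟩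
  obtain ⟨g', hg'⟩ : ∃ F : WithConv (PathCoalgebra k V →ₗ[k] A), F = toConv g := ⟨_, rfl⟩
  have hFf : ∀ x, F x = f x := fun x => by rw [hF]
  have hGg : ∀ x, g' x = g x := fun x => by rw [hg']
  have vanish : ∀ X Y : WithConv (PathCoalgebra k V →ₗ[k] A),
      (∀ a : V, X (vertex k a) * Y (vertex k a) = 1) →
      ∀ (a b : V) (p : Quiver.Path a b), p.length = 0 → (1 - X * Y) (path k p) = 0 := by
    intro X Y hXY a b p hp
    match p, hp with
    | .nil, _ =>
      rw [convSub_apply, convOne_path, convMul_path]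
      have := hXY a
      rw [vertex] at this
      simp [pathSplits, this]
  have hh := vanish g' F (fun a => by rw [hFf, hGg]; exact hgf a)
  have hh' := vanish F g' (fun a => by rw [hFf, hGg]; exact hfg a)
  obtain ⟨h, hhd⟩ : ∃ h, h = 1 - g' * F := ⟨_, rfl⟩
  obtain ⟨h', hhd'⟩ : ∃ h, h = 1 - F * g' := ⟨_, rfl⟩
  rw [← hhd] at hh
  rw [← hhd'] at hh'
  -- Since `g' * F = 1 - h`, a left inverse of `F` is the series of all `h ^ n * g'`. As `h` kills
  -- the vertices, the terms with `n` above the length of a path vanish on it, so truncation there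
  -- is harmless.
  let s : PathCoalgebra k V →ₗ[k] A := (basis k).constr k fun p =>
    (∑ n ∈ Finset.range (p.length + 1), h ^ n * g') (path k p.2.2)
  have hs : ∀ {a b : V} (p : Quiver.Path a b) (m : ℕ), p.length ≤ m →
      (toConv s) (path k p) = (∑ n ∈ Finset.range (m + 1), h ^ n * g') (path k p) := by
    intro a b p m hm
    refine (Module.Basis.constr_basis _ _ _ _).trans ?_
    rw [convSum_apply, convSum_apply]
    refine Finset.sum_subset (Finset.range_subset_range.2 (Nat.succ_le_succ hm)) fun n _ hn => ?_
    refine convMul_path_eq_zero (convPow_path_eq_zero hh n) p ?_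
    rw [Finset.mem_range, not_lt] at hn
    exact hn
  refine ⟨s, ?_, ?_, ?_⟩
  · rw [← hF]
    refine WithConv.ofConv_injective (hom_ext k fun a b p => ?_)
    refine (convMul_congr_left F p fun c d q hq => hs q p.length hq).trans ?_
    have : (∑ n ∈ Finset.range (p.length + 1), h ^ n * g') * F = 1 - h ^ (p.length + 1) := by
      rw [← Finset.sum_mul, mul_assoc, ← geom_sum_mul_neg, hhd]
      simp
    rw [this]
    rw [convSub_apply, convPow_path_eq_zero hh _ p (Nat.lt_succ_self _), sub_zero]
  · rw [← hF]
    refine WithConv.ofConv_injective (hom_ext k fun a b p => ?_)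
    refine (convMul_congr_right F p fun c d q hq => hs q p.length hq).trans ?_
    -- Moving `g'` to the left of the series turns powers of `h` into powers of `h'`, so the same
    -- `s` is also a right inverse.
    have hsc : SemiconjBy g' h' h := by
      rw [SemiconjBy, hhd, hhd', mul_sub, sub_mul, mul_one, one_mul, mul_assoc]
    have : F * (∑ n ∈ Finset.range (p.length + 1), h ^ n * g') = 1 - h' ^ (p.length + 1) := by
      rw [← mul_neg_geom_sum, Finset.sum_congr rfl fun n _ => (hsc.pow_right n).eq.symm,
        ← Finset.mul_sum, ← mul_assoc, hhd']
      simp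
    rw [this]
    rw [convSub_apply, convPow_path_eq_zero hh' _ p (Nat.lt_succ_self _), sub_zero]
  -- The maps of degree zero contain 1, `F` and `g'` and are closed under convolution, hence contain
  -- every term of the series.
  · let D : Set (WithConv (PathCoalgebra k V →ₗ[k] A)) :=
      {X | ∀ (a b : V) (p : Quiver.Path a b), X (path k p) ∈ N p.length}
    have D1 : 1 ∈ D := fun a b p => by
      rw [convOne_path]
      split_ifs with hp
      · rw [hp]; exact hN1
      · exact zero_mem _
    have Dmul : ∀ X ∈ D, ∀ Y ∈ D, X * Y ∈ D := fun X hX Y hY a b p => by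
      rw [convMul_path]
      refine list_sum_mem_of_forall _ _ _ fun t ht => ?_
      rw [← length_add_length_of_mem_pathSplits p t ht]
      exact hN _ _ _ _ (hX _ _ _) (hY _ _ _)
    have DF : F ∈ D := fun a b p => by rw [hFf]; exact hf a b p
    have DG : g' ∈ D := fun a b p => by rw [hGg]; exact hg a b p
    have Dh : h ∈ D := fun a b p => by
      rw [hhd]
      exact sub_mem (D1 a b p) (Dmul _ DG _ DF a b p)
    have Dpow : ∀ n, h ^ n ∈ D := fun n => by
      induction n with
      | zero => rw [pow_zero]; exact D1
      | succ n ih => rw [pow_succ]; exact Dmul _ ih _ Dh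
    intro a b p
    have := hs p p.length le_rfl
    rw [convSum_apply] at this
    refine (show s (path k p) = _ from this) ▸ ?_
    exact sum_mem fun n _ => Dmul _ (Dpow n) _ DG a b p

end Convolution

/-! ### Substituting combinations of arrows for arrows -/

section Gauge

variable {k : Type w} [Field k] {V : Type u} [Quiver.{v} V]

/-- Appending a combination of arrows to a path. -/
noncomputable def consBilin : PathCoalgebra k V →ₗ[k] PathCoalgebra k V →ₗ[k] PathCoalgebra k V :=
  (basis k).constr k fun
    | ⟨_, _, .cons .nil e⟩ => consL e
    | _ => 0

theorem consBilin_toPath {a b : V} (e : a ⟶ b) : consBilin (path k e.toPath) = consL e :=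
  Module.Basis.constr_basis ..

theorem consBilin_vertex {a b : V} {w : PathCoalgebra k V} (hw : w ∈ arrowSpan k a b) :
    consBilin w (vertex k a) = w := by
  induction hw using Submodule.span_induction with
  | mem x h =>
    obtain ⟨e, rfl⟩ := h
    simp only [consBilin_toPath, consL_vertex]
  | zero => simp
  | add x y _ _ hx hy => rw [map_add, LinearMap.add_apply, hx, hy]
  | smul r x _ hx => rw [map_smul, LinearMap.smul_apply, hx]

theorem comul_consBilin {a b : V} {w : PathCoalgebra k V} (hw : w ∈ arrowSpan k a b)
    (x : PathCoalgebra k V) :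
    Coalgebra.comul (R := k) (consBilin w x) = vertex k b ⊗ₜ[k] consBilin w x +
      (consBilin w).rTensor (PathCoalgebra k V) (Coalgebra.comul (R := k) x) := by
  induction hw using Submodule.span_induction with
  | mem x h => obtain ⟨e, rfl⟩ := h; simp only [consBilin_toPath, comul_consL]
  | zero => simp
  | add x y _ _ hx hy =>
    simp only [map_add, LinearMap.add_apply, hx, hy, TensorProduct.tmul_add,
      LinearMap.rTensor_add]
    abel
  | smul r x _ hx =>
    simp only [map_smul, LinearMap.smul_apply, hx, TensorProduct.tmul_smul, smul_add,
      LinearMap.rTensor_smul]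

theorem counit_consBilin {a b : V} {w : PathCoalgebra k V} (hw : w ∈ arrowSpan k a b)
    (x : PathCoalgebra k V) : Coalgebra.counit (R := k) (consBilin w x) = 0 := by
  induction hw using Submodule.span_induction with
  | mem x h => obtain ⟨e, rfl⟩ := h; simp only [consBilin_toPath, counit_consL]
  | zero => simp
  | add x y _ _ hx hy => simp only [map_add, LinearMap.add_apply, hx, hy, add_zero]
  | smul r x _ hx => simp only [map_smul, LinearMap.smul_apply, hx, smul_zero]

theorem consBilin_mem_degree {a b : V} {w : PathCoalgebra k V} (hw : w ∈ arrowSpan k a b)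
    {n : ℕ} {x : PathCoalgebra k V} (hx : x ∈ degree k V n) :
    consBilin w x ∈ degree k V (n + 1) := by
  induction hw using Submodule.span_induction with
  | mem y h => obtain ⟨e, rfl⟩ := h; simp only [consBilin_toPath]; exact consL_mem_degree e hx
  | zero => simp
  | add y z _ _ hy hz => rw [map_add, LinearMap.add_apply]; exact add_mem hy hz
  | smul r y _ hy => rw [map_smul, LinearMap.smul_apply]; exact Submodule.smul_mem _ _ hy

variable (ψ : ∀ {a b : V}, (a ⟶ b) → PathCoalgebra k V)

/-- The image of a path under the substitution `ψ` of combinations of arrows for arrows. -/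
noncomputable def gaugePath {a : V} : ∀ {b : V}, Quiver.Path a b → PathCoalgebra k V
  | _, .nil => vertex k a
  | _, .cons p e => consBilin (ψ e) (gaugePath p)

/-- The endomorphism of the path coalgebra which fixes the vertices and is `ψ` on the arrows. -/
noncomputable def gauge : PathCoalgebra k V →ₗ[k] PathCoalgebra k V :=
  (basis k).constr k fun p => gaugePath ψ p.2.2

theorem gauge_path {a b : V} (p : Quiver.Path a b) : gauge ψ (path k p) = gaugePath ψ p :=
  Module.Basis.constr_basis ..

theorem gauge_vertex (a : V) : gauge ψ (vertex k a) = vertex k a :=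
  gauge_path ψ _

variable {ψ}

theorem gauge_toPath (hψ : ∀ {a b : V} (e : a ⟶ b), ψ e ∈ arrowSpan k a b)
    {a b : V} (e : a ⟶ b) : gauge ψ (path k e.toPath) = ψ e := by
  rw [gauge_path, Quiver.Hom.toPath, gaugePath, gaugePath, consBilin_vertex (hψ e)]

theorem gauge_path_mem_degree
    (hψ : ∀ {a b : V} (e : a ⟶ b), ψ e ∈ arrowSpan k a b)
    {a b : V} (p : Quiver.Path a b) :
    gauge ψ (path k p) ∈ degree k V p.length := by
  rw [gauge_path]
  induction p with
  | nil => exact vertex_mem_degree a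
  | cons p e ih => exact consBilin_mem_degree (hψ e) ih

/-- The coproduct rule for appending a combination of arrows involves only its common end vertex,
and `ψ` preserves end points; induction on the path then applies. -/
theorem comul_comp_gauge (hψ : ∀ {a b : V} (e : a ⟶ b), ψ e ∈ arrowSpan k a b) :
    Coalgebra.comul ∘ₗ gauge ψ =
    TensorProduct.map (gauge ψ) (gauge ψ) ∘ₗ Coalgebra.comul := by
  refine hom_ext k fun a b p => ?_
  simp only [LinearMap.comp_apply]
  induction p with
  | nil =>
    change Coalgebra.comul (gauge ψ (vertex k a)) =
      TensorProduct.map _ _ (Coalgebra.comul (vertex k a))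
    rw [gauge_vertex, comul_vertex, TensorProduct.map_tmul, gauge_vertex]
  | @cons b c p e ih =>
    rw [gauge_path, gaugePath, comul_consBilin (hψ e), ← gauge_path, ih, comul_path, comul_path]
    simp only [pathSplits, List.map_cons, List.map_map, List.sum_cons, Function.comp_def,
      map_add, map_list_sum, TensorProduct.map_tmul, LinearMap.rTensor_tmul]
    simp only [gauge_path, gaugePath]

theorem counit_comp_gauge (hψ : ∀ {a b : V} (e : a ⟶ b), ψ e ∈ arrowSpan k a b) :
    Coalgebra.counit ∘ₗ gauge ψ = Coalgebra.counit (R := k) := by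
  refine hom_ext k fun a b p => ?_
  rw [LinearMap.comp_apply, counit_path]
  cases p with
  | nil => rw [← vertex_eq_path, gauge_vertex, counit_vertex]; simp
  | cons p e => rw [gauge_path, gaugePath, counit_consBilin (hψ e)]; simp

/-- `gauge ψ` as a morphism of coalgebras. -/
noncomputable def gaugeHom (ψ : ∀ {a b : V}, (a ⟶ b) → PathCoalgebra k V)
    (hψ : ∀ {a b : V} (e : a ⟶ b), ψ e ∈ arrowSpan k a b) :
    PathCoalgebra k V →ₗc[k] PathCoalgebra k V where
  toLinearMap := gauge ψ
  counit_comp := counit_comp_gauge hψ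
  map_comp_comul := (comul_comp_gauge hψ).symm

theorem gauge_mem_degree (hψ : ∀ {a b : V} (e : a ⟶ b), ψ e ∈ arrowSpan k a b) {n : ℕ}
    {x : PathCoalgebra k V} (hx : x ∈ degree k V n) : gauge ψ x ∈ degree k V n :=
  map_mem_of_path (fun _ _ p => gauge_path_mem_degree hψ p) _ _ hx

theorem gaugeHom_comp_gaugeHom {ψ' : ∀ {a b : V}, (a ⟶ b) → PathCoalgebra k V}
    (hψ : ∀ {a b : V} (e : a ⟶ b), ψ e ∈ arrowSpan k a b)
    (hψ' : ∀ {a b : V} (e : a ⟶ b), ψ' e ∈ arrowSpan k a b)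
    (h : ∀ {a b : V} (e : a ⟶ b), gauge ψ' (ψ e) = path k e.toPath) :
    (gaugeHom ψ' hψ').comp (gaugeHom ψ hψ) = CoalgHom.id k _ := by
  refine hom_eq_of_eq_on_arrows ?_ ?_ ?_
  · exact fun a b p => gauge_mem_degree hψ' (gauge_path_mem_degree hψ p)
  · exact fun a b p => path_mem_degree p rfl
  · intro a b p hp
    match p, hp with
    | .nil, _ =>
      change gauge ψ' (gauge ψ (vertex k a)) = vertex k a
      rw [gauge_vertex, gauge_vertex]
    | .cons .nil e, _ =>
      change gauge ψ' (gauge ψ (path k e.toPath)) = path k e.toPath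
      rw [gauge_toPath hψ, h]

end Gauge

end PathCoalgebra

/-! ### Group-like and skew-primitive elements; antipodes -/

section CoalgebraLemmas

variable {k : Type u} [Field k] {A : Type v} [AddCommGroup A] [Module k A] [Coalgebra k A]

theorem HopfStructure.comul_mul (H : HopfStructure k A) (x : A ⊗[k] A) :
    Coalgebra.comul (R := k) (H.mul x) =
      TensorProduct.map H.mul.toLinearMap H.mul.toLinearMap (Coalgebra.comul (R := k) x) :=
  (CoalgHomClass.map_comp_comul_apply H.mul x).symm

theorem comul_tmul_of_groupLike_left {g w x y : A}
    (hg : Coalgebra.comul (R := k) g = g ⊗ₜ[k] g)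
    (hw : Coalgebra.comul (R := k) w = y ⊗ₜ[k] w + w ⊗ₜ[k] x) :
    Coalgebra.comul (R := k) (g ⊗ₜ[k] w) =
      (g ⊗ₜ[k] y) ⊗ₜ[k] (g ⊗ₜ[k] w) + (g ⊗ₜ[k] w) ⊗ₜ[k] (g ⊗ₜ[k] x) := by
  rw [TensorProduct.comul_tmul, hg, hw, TensorProduct.tmul_add, map_add]
  rfl

theorem comul_tmul_of_groupLike_right {g w x y : A}
    (hg : Coalgebra.comul (R := k) g = g ⊗ₜ[k] g)
    (hw : Coalgebra.comul (R := k) w = y ⊗ₜ[k] w + w ⊗ₜ[k] x) :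
    Coalgebra.comul (R := k) (w ⊗ₜ[k] g) =
      (y ⊗ₜ[k] g) ⊗ₜ[k] (w ⊗ₜ[k] g) + (w ⊗ₜ[k] g) ⊗ₜ[k] (x ⊗ₜ[k] g) := by
  rw [TensorProduct.comul_tmul, hg, hw, TensorProduct.add_tmul, map_add]
  rfl

theorem comul_tmul_of_groupLike {g h : A}
    (hg : Coalgebra.comul (R := k) g = g ⊗ₜ[k] g)
    (hh : Coalgebra.comul (R := k) h = h ⊗ₜ[k] h) :
    Coalgebra.comul (R := k) (g ⊗ₜ[k] h) = (g ⊗ₜ[k] h) ⊗ₜ[k] (g ⊗ₜ[k] h) := by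
  rw [TensorProduct.comul_tmul, hg, hh]
  rfl

/-- On a group-like element of `A ⊗ A` convolution is multiplication of values, so an invertible
form has an invertible value there. -/
theorem IsUniversalRForm.apply_ne_zero {H : HopfStructure k A} {r : A ⊗[k] A →ₗ[k] k}
    (hr : IsUniversalRForm H r) {g h : A} (hg : Coalgebra.comul (R := k) g = g ⊗ₜ[k] g)
    (hh : Coalgebra.comul (R := k) h = h ⊗ₜ[k] h) (cg : Coalgebra.counit (R := k) g = 1)
    (ch : Coalgebra.counit (R := k) h = 1) : r (g ⊗ₜ h) ≠ 0 := by
  intro h0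
  obtain ⟨s, hs⟩ := hr.isUnit.exists_right_inv
  have := congrArg (fun f : WithConv (A ⊗[k] A →ₗ[k] k) => f (g ⊗ₜ h)) hs
  simp [comul_tmul_of_groupLike hg hh, h0, cg, ch] at this

/-- A morphism of Hopf algebras commutes with the antipodes. -/
theorem HopfStructure.map_antipode {S T : HopfStructure k A} (φ : A →ₗc[k] A)
    (hmul : ∀ x y, φ (S.mul (x ⊗ₜ y)) = T.mul (φ x ⊗ₜ φ y)) (hone : φ S.one = T.one) (x : A) :
    φ (S.antipode x) = T.antipode (φ x) := by
  let := T.ring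
  let := T.algebra
  have hm : ∀ z : A ⊗[k] A, LinearMap.mul' k A z = T.mul z := fun z =>
    (HopfStructure.apply_eq_mul' (B := A) (T.mul : A ⊗[k] A →ₗ[k] A) (fun _ _ => rfl) z).symm
  -- The two composites are a left (`h1`) and a right (`h2`) convolution inverse of `φ`, hence
  -- equal.
  have h1 : WithConv.toConv (φ.toLinearMap ∘ₗ S.antipode) * WithConv.toConv φ.toLinearMap = 1 := by
    refine WithConv.ofConv_injective (LinearMap.ext fun a => ?_)
    refine (LinearMap.convMul_apply _ _ a).trans ?_
    have : ∀ z : A ⊗[k] A, LinearMap.mul' k A (TensorProduct.map (φ.toLinearMap ∘ₗ S.antipode)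
        φ.toLinearMap z) = φ (S.mul (TensorProduct.map S.antipode LinearMap.id z)) := by
      intro z
      induction z with
      | zero => simp
      | tmul x y => rw [hm]; exact (hmul _ _).symm
      | add x y hx hy => simp only [map_add, hx, hy]
    refine (this _).trans ?_
    rw [S.mul_antipode_left, map_smul, hone]
    exact (Algebra.algebraMap_eq_smul_one _).symm
  have h2 : WithConv.toConv φ.toLinearMap * WithConv.toConv (T.antipode ∘ₗ φ.toLinearMap) = 1 := by
    refine WithConv.ofConv_injective (LinearMap.ext fun a => ?_)
    refine (LinearMap.convMul_apply _ _ a).trans ?_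
    have : TensorProduct.map φ.toLinearMap (T.antipode ∘ₗ φ.toLinearMap)
        (Coalgebra.comul (R := k) a) =
        TensorProduct.map LinearMap.id T.antipode (Coalgebra.comul (R := k) (φ a)) := by
      rw [← CoalgHomClass.map_comp_comul_apply]
      generalize Coalgebra.comul (R := k) a = z
      induction z with
      | zero => simp
      | tmul x y => rfl
      | add x y hx hy => simp only [map_add, hx, hy]
    rw [hm]
    refine (congrArg T.mul this).trans ?_
    rw [T.mul_antipode_right, CoalgHomClass.counit_comp_apply]
    exact (Algebra.algebraMap_eq_smul_one _).symm
  exact LinearMap.congr_fun (congrArg WithConv.ofConv (left_inv_eq_right_inv h1 h2)) x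

end CoalgebraLemmas

/-! ### Vertices acting on arrows -/

section HopfQuiver

open PathCoalgebra

variable {k : Type v} [Field k] {G : Type u} [Group G] {R : ConjClasses G → ℕ}

instance : Group (HopfQuiver R) := inferInstanceAs (Group G)

namespace HopfQuiver

local notation "kQ" => PathCoalgebra k (HopfQuiver R)

/-- The vertex 1 is idempotent, and the antipode gives it a left inverse. -/
theorem one_eq_vertex {H : HopfStructure k kQ}
    (hv : ∀ a b : HopfQuiver R, H.mul (vertex k a ⊗ₜ vertex k b) = vertex k (a * b)) :
    H.one = vertex k (1 : HopfQuiver R) := by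
  have h := H.mul_antipode_left (vertex k (1 : HopfQuiver R))
  rw [comul_vertex, counit_vertex, one_smul, TensorProduct.map_tmul, LinearMap.id_apply] at h
  rw [← H.one_mul (vertex k 1), ← h, H.mul_assoc, hv, mul_one]

theorem mul_vertex_mul_vertex {H : HopfStructure k kQ}
    (hv : ∀ a b : HopfQuiver R, H.mul (vertex k a ⊗ₜ vertex k b) = vertex k (a * b))
    (a b : HopfQuiver R) (x : kQ) :
    H.mul (vertex k a ⊗ₜ H.mul (vertex k b ⊗ₜ x)) = H.mul (vertex k (a * b) ⊗ₜ x) := by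
  rw [← H.mul_assoc, hv]

theorem vertex_one_mul {H : HopfStructure k kQ}
    (hv : ∀ a b : HopfQuiver R, H.mul (vertex k a ⊗ₜ vertex k b) = vertex k (a * b))
    (x : kQ) : H.mul (vertex k (1 : HopfQuiver R) ⊗ₜ x) = x := by
  rw [← one_eq_vertex hv, H.one_mul]

/-- Multiplication by a group-like element of degree zero preserves skew-primitivity and degree, and
skew-primitives of degree one are combinations of arrows. -/
theorem vertex_mul_mem_arrowSpan {S : CQTStructure k R}
    (hv : ∀ a b : HopfQuiver R, S.mul (vertex k a ⊗ₜ vertex k b) = vertex k (a * b))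
    {a b : HopfQuiver R} (g : HopfQuiver R) {w : kQ} (hw : w ∈ arrowSpan k a b) :
    S.mul (vertex k g ⊗ₜ w) ∈ arrowSpan k (g * a) (g * b) := by
  refine mem_arrowSpan_of_comul ?_ ?_
  · simpa using S.mul_mem 0 1 _ _ (vertex_mem_degree g) (arrowSpan_le_degree _ _ hw)
  · rw [S.comul_mul, comul_tmul_of_groupLike_left (comul_vertex g) (comul_of_mem_arrowSpan hw),
      map_add, TensorProduct.map_tmul, TensorProduct.map_tmul, ← hv, ← hv]
    rfl

/-- On two vertices the third axiom compares `b * a` with `a * b` up to the same nonzero scalar on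
both sides. -/
theorem mul_comm_of_hasVertexGroup {S : CQTStructure k R} (hS : HasVertexGroup S)
    (a b : HopfQuiver R) : a * b = b * a := by
  have h := S.isUniversalRForm.comm (vertex k a) (vertex k b)
  rw [comul_tmul_of_groupLike (comul_vertex a) (comul_vertex b)] at h
  simp only [TensorProduct.map_tmul, LinearMap.comp_apply, LinearEquiv.coe_coe,
    TensorProduct.comm_tmul, TensorProduct.rid_tmul, TensorProduct.lid_tmul] at h
  have h' := smul_right_injective _ (S.isUniversalRForm.apply_ne_zero (comul_vertex a)
    (comul_vertex b) (counit_vertex a) (counit_vertex b)) h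
  have h2 : vertex k (b * a) = vertex k (a * b) := (hS b a).symm.trans (h'.trans (hS a b))
  exact congrArg Sigma.fst ((basis k).injective h2).symm

/-! ### The form on vertices is a skew-symmetric bicharacter -/

variable (S : DegreeZeroStructure k R)

theorem DegreeZeroStructure.vertex_mul_vertex (a b : HopfQuiver R) :
    S.1.mul (vertex k a ⊗ₜ vertex k b) = vertex k (a * b) :=
  S.2.1 a b

/-- The restriction of the universal form to vertices. -/
noncomputable def DegreeZeroStructure.form (a b : HopfQuiver R) : k :=
  S.1.rForm (vertex k a ⊗ₜ vertex k b)

theorem DegreeZeroStructure.form_ne_zero (a b : HopfQuiver R) : S.form a b ≠ 0 :=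
  S.1.isUniversalRForm.apply_ne_zero (comul_vertex a) (comul_vertex b) (counit_vertex a)
    (counit_vertex b)

theorem DegreeZeroStructure.form_mul_left (a b c : HopfQuiver R) :
    S.form (a * b) c = S.form a c * S.form b c := by
  have h := S.1.isUniversalRForm.mul_left (vertex k a) (vertex k b) (vertex k c)
  rwa [comul_vertex, S.vertex_mul_vertex] at h

theorem DegreeZeroStructure.form_mul_right (a b c : HopfQuiver R) :
    S.form a (b * c) = S.form a b * S.form a c := by
  have h := S.1.isUniversalRForm.mul_right (vertex k a) (vertex k b) (vertex k c)
  rw [comul_vertex, S.vertex_mul_vertex] at h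
  exact h.trans (mul_comm _ _)

theorem DegreeZeroStructure.form_one_left (a : HopfQuiver R) : S.form 1 a = 1 := by
  have h := S.form_mul_left 1 1 a
  rw [mul_one] at h
  exact (mul_eq_left₀ (S.form_ne_zero 1 a)).1 h.symm

theorem DegreeZeroStructure.form_one_right (a : HopfQuiver R) : S.form a 1 = 1 := by
  have h := S.form_mul_right a 1 1
  rw [mul_one] at h
  exact (mul_eq_left₀ (S.form_ne_zero a 1)).1 h.symm

/-- This is the third axiom for the pair `(w, g)`: on each side one of the two terms carries `𝓡(w,
g)`, which is zero by concentration in degree 0. -/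
theorem DegreeZeroStructure.form_smul_vertex_mul {a b : HopfQuiver R} (g : HopfQuiver R) {w : kQ}
    (hw : w ∈ arrowSpan k a b) :
    S.form a g • S.1.mul (vertex k g ⊗ₜ w) = S.form b g • S.1.mul (w ⊗ₜ vertex k g) := by
  have h := S.1.isUniversalRForm.comm w (vertex k g)
  rw [comul_tmul_of_groupLike_right (comul_vertex g) (comul_of_mem_arrowSpan hw)] at h
  have h0 : S.1.rForm (w ⊗ₜ vertex k g) = 0 :=
    S.2.2 1 0 _ _ (arrowSpan_le_degree _ _ hw) (vertex_mem_degree g) (by simp)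
  simpa [form, h0] using h

theorem DegreeZeroStructure.form_smul_mul_vertex {a b : HopfQuiver R} (g : HopfQuiver R) {w : kQ}
    (hw : w ∈ arrowSpan k a b) :
    S.form g a • S.1.mul (w ⊗ₜ vertex k g) = S.form g b • S.1.mul (vertex k g ⊗ₜ w) := by
  have h := S.1.isUniversalRForm.comm (vertex k g) w
  rw [comul_tmul_of_groupLike_left (comul_vertex g) (comul_of_mem_arrowSpan hw)] at h
  have h0 : S.1.rForm (vertex k g ⊗ₜ w) = 0 :=
    S.2.2 0 1 _ _ (vertex_mem_degree g) (arrowSpan_le_degree _ _ hw) (by simp)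
  simpa [form, h0] using h

/-- The two exchange relations take `g·e` to `e·g` and back. The scalars must agree because `g·e` is
nonzero, `g` being invertible. -/
theorem DegreeZeroStructure.form_mul_form_swap_eq {a b : HopfQuiver R} (e : a ⟶ b)
    (g : HopfQuiver R) : S.form a g * S.form g a = S.form b g * S.form g b := by
  have he := toPath_mem_arrowSpan (k := k) e
  have h1 := S.form_smul_vertex_mul g he
  have h2 := S.form_smul_mul_vertex g he
  have hne : S.1.mul (vertex k g ⊗ₜ path k e.toPath) ≠ 0 := by
    intro h0
    have := mul_vertex_mul_vertex S.vertex_mul_vertex g⁻¹ g (path k e.toPath)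
    rw [h0, inv_mul_cancel, vertex_one_mul S.vertex_mul_vertex, TensorProduct.tmul_zero,
      map_zero] at this
    exact path_ne_zero _ this.symm
  refine smul_left_injective k hne ?_
  change (S.form a g * S.form g a) • _ = (S.form b g * S.form g b) • _
  rw [mul_comm, mul_smul, h1, smul_comm, h2, ← mul_smul]

/-- The product is 1 at the vertex 1 and is unchanged along an arrow, traversed in either direction.
-/
theorem DegreeZeroStructure.form_mul_form_swap (hconn : IsConnectedQuiver (HopfQuiver R))
    (a g : HopfQuiver R) : S.form a g * S.form g a = 1 := by
  have key : ∀ b : HopfQuiver R,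
      ∀ _ : @Quiver.Path (Quiver.Symmetrify (HopfQuiver R)) _ (1 : HopfQuiver R) b,
        S.form b g * S.form g b = 1 := by
    intro b p
    induction p with
    | nil => rw [S.form_one_left, S.form_one_right, mul_one]
    | cons p e ih =>
      rcases e with e | e
      · rw [← S.form_mul_form_swap_eq e, ih]
      · rw [S.form_mul_form_swap_eq e, ih]
  obtain ⟨p⟩ := (Quiver.WeaklyConnectedComponent.eq _ _).1 (hconn.2 1 a)
  exact key a p

/-- The skew-symmetric bicharacter defined by a structure concentrated in degree zero. -/
noncomputable def DegreeZeroStructure.bicharacter (hconn : IsConnectedQuiver (HopfQuiver R)) :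
    SkewSymmetricBicharacter k G where
  toFun := S.form
  map_mul_right := S.form_mul_right
  map_mul_left := S.form_mul_left
  map_one_right := S.form_one_right
  map_one_left := S.form_one_left
  skew := S.form_mul_form_swap hconn

/-! ### Comparison of two structures with the same form -/

/-- The images of the arrows under the comparison of two structures. -/
noncomputable def DegreeZeroStructure.comparison (S T : DegreeZeroStructure k R)
    {a b : HopfQuiver R} (e : a ⟶ b) : kQ :=
  T.1.mul (vertex k a ⊗ₜ S.1.mul (vertex k a⁻¹ ⊗ₜ path k e.toPath))

variable (T : DegreeZeroStructure k R)

/-- Translation by `a⁻¹` in `S` moves the source to 1, and translation by `a` in `T` restores both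
end points. -/
theorem DegreeZeroStructure.comparison_mem_arrowSpan {a b : HopfQuiver R} (e : a ⟶ b) :
    S.comparison T e ∈ arrowSpan k a b := by
  have h := vertex_mul_mem_arrowSpan T.vertex_mul_vertex a
    (vertex_mul_mem_arrowSpan S.vertex_mul_vertex a⁻¹ (toPath_mem_arrowSpan (k := k) e))
  rwa [mul_inv_cancel_left, mul_inv_cancel_left] at h

theorem DegreeZeroStructure.gauge_comparison {a b : HopfQuiver R} {w : kQ}
    (hw : w ∈ arrowSpan k a b) : gauge (S.comparison T) w =
      T.1.mul (vertex k a ⊗ₜ S.1.mul (vertex k a⁻¹ ⊗ₜ w)) := by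
  induction hw using Submodule.span_induction with
  | mem x h =>
    obtain ⟨e, rfl⟩ := h
    exact gauge_toPath (S.comparison_mem_arrowSpan T) e
  | zero => simp
  | add x y _ _ hx hy => simp only [map_add, hx, hy, TensorProduct.tmul_add]
  | smul r x _ hx => simp only [map_smul, hx, TensorProduct.tmul_smul]

theorem DegreeZeroStructure.gauge_comparison_comparison {a b : HopfQuiver R} (e : a ⟶ b) :
    gauge (T.comparison S) (S.comparison T e) = path k e.toPath := by
  rw [T.gauge_comparison S (S.comparison_mem_arrowSpan T e), comparison,
    mul_vertex_mul_vertex T.vertex_mul_vertex, inv_mul_cancel, vertex_one_mul T.vertex_mul_vertex,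
    mul_vertex_mul_vertex S.vertex_mul_vertex, mul_inv_cancel, vertex_one_mul S.vertex_mul_vertex]

/-- The source of `g·w` is `g * a`, and `(g * a)⁻¹ * g` collapses to `a⁻¹`, so both sides translate
the same arrows from source 1 by `g * a`. -/
theorem DegreeZeroStructure.gauge_comparison_vertex_mul {a b : HopfQuiver R} (g : HopfQuiver R)
    {w : kQ} (hw : w ∈ arrowSpan k a b) :
    gauge (S.comparison T) (S.1.mul (vertex k g ⊗ₜ w)) =
      T.1.mul (vertex k g ⊗ₜ gauge (S.comparison T) w) := by
  rw [S.gauge_comparison T (vertex_mul_mem_arrowSpan S.vertex_mul_vertex g hw),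
    S.gauge_comparison T hw, mul_vertex_mul_vertex S.vertex_mul_vertex,
    mul_vertex_mul_vertex T.vertex_mul_vertex, mul_inv_rev, inv_mul_cancel_right]

theorem gauge_mem_arrowSpan {V : Type*} [Quiver V]
    {ψ : ∀ {a b : V}, (a ⟶ b) → PathCoalgebra k V}
    (hψ : ∀ {a b : V} (e : a ⟶ b), ψ e ∈ arrowSpan k a b) {a b : V} {w : PathCoalgebra k V}
    (hw : w ∈ arrowSpan k a b) : gauge ψ w ∈ arrowSpan k a b := by
  induction hw using Submodule.span_induction with
  | mem x h => obtain ⟨e, rfl⟩ := h; simp only [gauge_toPath hψ]; exact hψ e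
  | zero => simp
  | add x y _ _ hx hy => rw [map_add]; exact add_mem hx hy
  | smul r x _ hx => rw [map_smul]; exact Submodule.smul_mem _ _ hx

/-- Right linearity follows from left linearity: with a common form, the exchange relation expresses
the right action through the left one by the same nonzero scalars in `S` and `T`. -/
theorem DegreeZeroStructure.gauge_comparison_mul_vertex (h : ∀ a b, S.form a b = T.form a b)
    {a b : HopfQuiver R} (g : HopfQuiver R) {w : kQ} (hw : w ∈ arrowSpan k a b) :
    gauge (S.comparison T) (S.1.mul (w ⊗ₜ vertex k g)) =
      T.1.mul (gauge (S.comparison T) w ⊗ₜ vertex k g) := by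
  have h1 := S.form_smul_vertex_mul g hw
  have h2 := T.form_smul_vertex_mul g (gauge_mem_arrowSpan (S.comparison_mem_arrowSpan T) hw)
  refine smul_right_injective _ (S.form_ne_zero b g) ?_
  change S.form b g • _ = S.form b g • _
  rw [← map_smul, ← h1, map_smul, S.gauge_comparison_vertex_mul T g hw, h, h2, h]

/-- The comparison of two structures with the same restriction to vertices is multiplicative. -/
theorem DegreeZeroStructure.gauge_comparison_mul (h : ∀ a b, S.form a b = T.form a b) (x y : kQ) :
    gauge (S.comparison T) (S.1.mul (x ⊗ₜ y)) =
      T.1.mul (gauge (S.comparison T) x ⊗ₜ gauge (S.comparison T) y) := by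
  let φ := gaugeHom (S.comparison T) (S.comparison_mem_arrowSpan T)
  suffices key : φ.comp S.1.mul = T.1.mul.comp (Coalgebra.TensorProduct.map φ φ) from
    DFunLike.congr_fun key (x ⊗ₜ y)
  have hφ := fun {n : ℕ} {x : kQ} => gauge_mem_degree (S.comparison_mem_arrowSpan T) (n := n)
    (x := x)
  refine hom_tensor_eq_of_eq_on_arrows ?_ ?_ ?_
  · exact fun _ _ _ _ p q => hφ (S.1.mul_mem _ _ _ _ (path_mem_degree p rfl)
      (path_mem_degree q rfl))
  · exact fun _ _ _ _ p q => T.1.mul_mem _ _ _ _ (hφ (path_mem_degree p rfl))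
      (hφ (path_mem_degree q rfl))
  · intro a b a' b' p q hpq
    change gauge (S.comparison T) (S.1.mul (path k p ⊗ₜ path k q)) =
      T.1.mul (gauge (S.comparison T) (path k p) ⊗ₜ gauge (S.comparison T) (path k q))
    match p, q, hpq with
    | .nil, .nil, _ =>
      simp only [← vertex_eq_path, gauge_vertex, vertex_mul_vertex]
    | .nil, .cons .nil e, _ =>
      have := S.gauge_comparison_vertex_mul T a (toPath_mem_arrowSpan e)
      rwa [← vertex_eq_path, gauge_vertex]
    | .cons .nil e, .nil, _ =>
      have := S.gauge_comparison_mul_vertex T h a' (toPath_mem_arrowSpan e)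
      rwa [← vertex_eq_path, gauge_vertex]
    | .cons _ _, .cons _ _, hpq => simp at hpq; lia
    | .cons (.cons _ _) _, .nil, hpq => simp at hpq
    | .nil, .cons (.cons _ _) _, hpq => simp at hpq

theorem DegreeZeroStructure.rForm_gauge_comparison (h : ∀ a b, S.form a b = T.form a b)
    (x y : kQ) : T.1.rForm (gauge (S.comparison T) x ⊗ₜ gauge (S.comparison T) y) =
      S.1.rForm (x ⊗ₜ y) := by
  suffices key : T.1.rForm ∘ₗ TensorProduct.map (gauge (S.comparison T)) (gauge (S.comparison T)) =
      S.1.rForm from LinearMap.congr_fun key (x ⊗ₜ y)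
  refine TensorProduct.ext (hom_ext k fun a b p => hom_ext k fun a' b' q => ?_)
  change T.1.rForm (gauge (S.comparison T) (path k p) ⊗ₜ gauge (S.comparison T) (path k q)) =
    S.1.rForm (path k p ⊗ₜ path k q)
  by_cases hpq : p.length = 0 ∧ q.length = 0
  · match p, q, hpq with
    | .nil, .nil, _ =>
      simp only [← vertex_eq_path, gauge_vertex]
      exact (h a a').symm
  · rw [S.2.2 _ _ _ _ (path_mem_degree p rfl) (path_mem_degree q rfl) hpq,
      T.2.2 _ _ _ _ (gauge_path_mem_degree (S.comparison_mem_arrowSpan T) p)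
        (gauge_path_mem_degree (S.comparison_mem_arrowSpan T) q) hpq]

theorem DegreeZeroStructure.iso_of_form_eq (h : ∀ a b, S.form a b = T.form a b) :
    DegreeZeroStructure.Iso S T := by
  have hone : gauge (S.comparison T) S.1.one = T.1.one := by
    rw [one_eq_vertex S.vertex_mul_vertex, one_eq_vertex T.vertex_mul_vertex, gauge_vertex]
  refine ⟨CoalgEquiv.ofCoalgHom
    (gaugeHom (S.comparison T) (S.comparison_mem_arrowSpan T))
    (gaugeHom (T.comparison S) (T.comparison_mem_arrowSpan S))
    (gaugeHom_comp_gaugeHom _ _ (T.gauge_comparison_comparison S))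
    (gaugeHom_comp_gaugeHom _ _ (S.gauge_comparison_comparison T)),
    S.gauge_comparison_mul T h, hone, ?_, ?_, S.rForm_gauge_comparison T h, ?_⟩
  · exact HopfStructure.map_antipode
      (gaugeHom (S.comparison T) (S.comparison_mem_arrowSpan T)) (S.gauge_comparison_mul T h) hone
  · exact fun n x hx => gauge_mem_degree (S.comparison_mem_arrowSpan T) hx
  · exact fun g => gauge_vertex _ _

theorem DegreeZeroStructure.form_eq_of_iso (h : DegreeZeroStructure.Iso S T)
    (a b : HopfQuiver R) : S.form a b = T.form a b := by
  obtain ⟨φ, -, -, -, -, hr, hv⟩ := h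
  have := hr (vertex k a) (vertex k b)
  have ha : φ (vertex k a) = vertex k a := hv a
  have hb : φ (vertex k b) = vertex k b := hv b
  rw [ha, hb] at this
  exact this.symm

end HopfQuiver

end HopfQuiver

/-! ### The quantum shuffle product of paths -/

section QuantumShuffle

open PathCoalgebra

variable {k : Type v} [Field k] {G : Type u} [Group G] {R : ConjClasses G → ℕ}

namespace HopfQuiver

local notation "kQ" => PathCoalgebra k (HopfQuiver R)

/-- The number of an arrow among the arrows with the same end points. -/
def label {a b : HopfQuiver R} (e : a ⟶ b) : ℕ := Fin.val e

theorem path_toPath_congr {a b a' b' : HopfQuiver R} (ha : a = a') (hb : b = b') (e : a ⟶ b)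
    (e' : a' ⟶ b') (h : label e = label e') : path k e.toPath = path k e'.toPath := by
  subst ha hb
  rw [show e = e' from Fin.ext h]

theorem consL_congr {a b a' b' : HopfQuiver R} (ha : a = a') (hb : b = b') (e : a ⟶ b)
    (e' : a' ⟶ b') (h : label e = label e') : consL (k := k) e = consL e' := by
  subst ha hb
  rw [show e = e' from Fin.ext h]

/-- The translation of an arrow from the left. -/
def leftShift (g : HopfQuiver R) {a b : HopfQuiver R} (e : a ⟶ b) : g * a ⟶ g * b :=
  -- Left translation conjugates `b * a⁻¹` by `g`, which preserves its class and hence the number of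
  -- arrows.
  Fin.cast (congrArg R (ConjClasses.mk_eq_mk_iff_isConj.2 (isConj_iff.2 ⟨(show G from g),
    show g * (b * a⁻¹) * g⁻¹ = g * b * (g * a)⁻¹ by group⟩))) e

/-- The translation of an arrow from the right. -/
def rightShift {a b : HopfQuiver R} (e : a ⟶ b) (g : HopfQuiver R) : a * g ⟶ b * g :=
  Fin.cast (congrArg (fun c : HopfQuiver R => R (ConjClasses.mk (show G from c)))
    (show b * a⁻¹ = b * g * (a * g)⁻¹ by group)) e

variable (β : SkewSymmetricBicharacter k (HopfQuiver R))

/-- The scalar by which the left and right actions of `g` on an arrow differ. -/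
def braidingScalar (a b g : HopfQuiver R) : k := β.toFun a g * β.toFun g b

/-- The product of two paths: the sum of all shuffles, with the coefficients defined by a
skew-symmetric bicharacter. -/
noncomputable def mulPath : ∀ {a b a' b' : HopfQuiver R},
    Quiver.Path a b → Quiver.Path a' b' → kQ
  | a, _, a', _, .nil, .nil => vertex k (a * a')
  | a, _, _, _, .nil, .cons q f => consL (leftShift a f) (mulPath (.nil : Quiver.Path a a) q)
  | _, _, a', _, .cons (b := b) (c := c) p e, .nil =>
      braidingScalar β b c a' •
        consL (rightShift e a') (mulPath p (.nil : Quiver.Path a' a'))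
  -- The last arrow of a shuffle is either `e`, moved from the right by the end vertex of the second
  -- path, or `f`, moved from the left by the end vertex of the first. Only the right action carries
  -- a scalar.
  | _, _, _, _, .cons (b := b) (c := c) p e, .cons (c := c') q f =>
      braidingScalar β b c c' • consL (rightShift e c') (mulPath p (q.cons f)) +
        consL (leftShift c f) (mulPath (p.cons e) q)
termination_by _ _ _ _ p q => p.length + q.length

/-- The recursion for `mulPath` is designed for this: each appended arrow is the product of an arrow
with the end vertex of the other path, so `comul_consL` reproduces the recursion in the terminal
factors. -/
theorem comul_mulPath {a b a' b' : HopfQuiver R} (p : Quiver.Path a b) (q : Quiver.Path a' b') :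
    Coalgebra.comul (R := k) (mulPath β p q) =
      ((pathSplits p).map fun s => ((pathSplits q).map fun t =>
        mulPath β s.later t.later ⊗ₜ[k] mulPath β s.earlier t.earlier).sum).sum := by
  induction p generalizing b' with
  | nil =>
    induction q with
    | nil => simp [pathSplits, mulPath, comul_vertex]
    | cons q f ih =>
      simp only [mulPath, comul_consL, ih]
      simp only [pathSplits, List.map_cons, List.map_nil, List.sum_cons, List.sum_nil, add_zero,
        mulPath, List.map_map, Function.comp_def, map_list_sum, LinearMap.rTensor_tmul]
  | cons p e ihp =>
    induction q with
    | nil =>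
      simp only [mulPath, map_smul, comul_consL, ihp]
      simp only [pathSplits, List.map_cons, List.map_nil, List.sum_cons, List.sum_nil, add_zero,
        mulPath, List.map_map, Function.comp_def, map_list_sum, LinearMap.rTensor_tmul,
        smul_add, List.smul_sum, TensorProduct.tmul_smul, TensorProduct.smul_tmul']
    | cons q f ihq =>
      simp only [mulPath, map_add, map_smul, comul_consL, ihp, ihq]
      simp only [pathSplits, List.map_cons, List.sum_cons,
        mulPath, List.map_map, Function.comp_def, map_list_sum, LinearMap.rTensor_tmul, map_add,
        smul_add, List.smul_sum, TensorProduct.tmul_smul, TensorProduct.smul_tmul',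
        TensorProduct.tmul_add, TensorProduct.add_tmul, List.sum_map_add]
      abel

theorem counit_mulPath {a b a' b' : HopfQuiver R} (p : Quiver.Path a b)
    (q : Quiver.Path a' b') : Coalgebra.counit (R := k) (mulPath β p q) =
      Coalgebra.counit (R := k) (path k p) * Coalgebra.counit (R := k) (path k q) := by
  cases p <;> cases q <;> simp [mulPath, counit_consL, counit_vertex, counit_path]

theorem mulPath_mem_degree {a b a' b' : HopfQuiver R} (p : Quiver.Path a b)
    (q : Quiver.Path a' b') :
    mulPath β p q ∈ degree k (HopfQuiver R) (p.length + q.length) := by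
  induction p generalizing b' with
  | nil =>
    induction q with
    | nil => rw [mulPath]; exact vertex_mem_degree _
    | cons q f ih => rw [mulPath]; exact consL_mem_degree _ ih
  | cons p e ihp =>
    induction q with
    | nil => rw [mulPath]; exact Submodule.smul_mem _ _ (consL_mem_degree _ (ihp .nil))
    | @cons c c' q f ihq =>
      rw [mulPath]
      refine add_mem (Submodule.smul_mem _ _ ?_) (consL_mem_degree _ ihq)
      have := consL_mem_degree (rightShift e c') (ihp (q.cons f))
      rwa [Nat.add_right_comm] at this

theorem braidingScalar_one (a b : HopfQuiver R) : braidingScalar β a b 1 = 1 := by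
  rw [braidingScalar, β.map_one_left, β.map_one_right, mul_one]

theorem one_mulPath {a b : HopfQuiver R} (q : Quiver.Path a b) :
    mulPath β (.nil : Quiver.Path (1 : HopfQuiver R) 1) q = path k q := by
  induction q with
  | nil => rw [mulPath, one_mul, vertex]
  | cons q f ih =>
    rw [mulPath, ih, consL_congr (one_mul _) (one_mul _) _ f rfl, consL_path]

theorem mulPath_one {a b : HopfQuiver R} (p : Quiver.Path a b) :
    mulPath β p (.nil : Quiver.Path (1 : HopfQuiver R) 1) = path k p := by
  induction p with
  | nil => rw [mulPath, mul_one, vertex]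
  | cons p e ih =>
    rw [mulPath, ih, consL_congr (mul_one _) (mul_one _) _ e rfl, consL_path, braidingScalar_one,
      one_smul]

variable {β} in
-- The third axiom for pairs of paths, once the form is reduced to end points. For abelian `G` left
-- and right translates of an arrow coincide, so the two recursions match term by term, and skew
-- symmetry cancels the braiding scalars.
theorem toFun_smul_mulPath_comm (hab : ∀ a b : HopfQuiver R, a * b = b * a)
    {a b a' b' : HopfQuiver R} (p : Quiver.Path a b) (q : Quiver.Path a' b') :
    β.toFun a a' • mulPath β q p = β.toFun b b' • mulPath β p q := by
  induction p generalizing b' with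
  | nil =>
    induction q with
    | nil => rw [mulPath, mulPath, hab]
    | @cons c c' q f ih =>
      rw [mulPath, mulPath, smul_smul, mul_comm, ← smul_smul, ← map_smul, ih, map_smul, smul_smul,
        consL_congr (hab _ _) (hab _ _) (rightShift f a) (leftShift a f) rfl, braidingScalar,
        mul_right_comm, β.skew, one_mul]
  | @cons d d' p e ihp =>
    induction q with
    | nil =>
      rw [mulPath, mulPath, ← map_smul, ihp, map_smul, smul_smul,
        consL_congr (hab _ _) (hab _ _) (rightShift e a') (leftShift a' e) rfl, braidingScalar,
        mul_comm (β.toFun d a'), ← mul_assoc, β.skew, one_mul]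
    | @cons c c' q f ihq =>
      rw [mulPath, mulPath, smul_add, smul_add, smul_smul, mul_comm, ← smul_smul, ← map_smul, ihq,
        ← map_smul (consL (leftShift c' e)), ihp, map_smul, map_smul, smul_smul, smul_smul, add_comm,
        consL_congr (hab _ _) (hab _ _) (rightShift e c') (leftShift c' e) rfl,
        consL_congr (hab _ _) (hab _ _) (rightShift f d') (leftShift d' f) rfl, braidingScalar,
        braidingScalar, mul_right_comm, β.skew, one_mul, mul_comm (β.toFun d c'), ← mul_assoc,
        β.skew, one_mul]

end HopfQuiver

end QuantumShuffle

/-! ### The Hopf structure defined by a bicharacter -/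

section Standard

open PathCoalgebra

variable {k : Type v} [Field k] {G : Type u} [Group G] {R : ConjClasses G → ℕ}

theorem PathCoalgebra.comul_path_tmul_path {V : Type*} [Quiver V] {a b a' b' : V}
    (p : Quiver.Path a b) (q : Quiver.Path a' b') :
    Coalgebra.comul (R := k) (path k p ⊗ₜ[k] path k q) =
      ((pathSplits p).map fun s => ((pathSplits q).map fun t =>
        (path k s.later ⊗ₜ[k] path k t.later) ⊗ₜ[k]
          (path k s.earlier ⊗ₜ[k] path k t.earlier)).sum).sum := by
  rw [TensorProduct.comul_tmul, comul_path, comul_path]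
  generalize pathSplits p = l
  induction l with
  | nil => simp
  | cons s l ih =>
    rw [List.map_cons, List.sum_cons, TensorProduct.add_tmul, map_add, ih, List.map_cons,
      List.sum_cons]
    congr 1
    generalize pathSplits q = l'
    induction l' with
    | nil => simp
    | cons t l' ih' =>
      rw [List.map_cons, List.sum_cons, TensorProduct.tmul_add, map_add, ih', List.map_cons,
        List.sum_cons]
      rfl

namespace HopfQuiver

local notation "kQ" => PathCoalgebra k (HopfQuiver R)

variable (β : SkewSymmetricBicharacter k (HopfQuiver R))

/-- The linear extension of `mulPath`. -/
noncomputable def mulLin : kQ ⊗[k] kQ →ₗ[k] kQ :=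
  TensorProduct.lift ((basis k).constr k fun p => (basis k).constr k fun q =>
    mulPath β p.2.2 q.2.2)

theorem mulLin_path {a b a' b' : HopfQuiver R} (p : Quiver.Path a b) (q : Quiver.Path a' b') :
    mulLin β (path k p ⊗ₜ path k q) = mulPath β p q := by
  rw [mulLin, TensorProduct.lift.tmul, path, path, Module.Basis.constr_basis,
    Module.Basis.constr_basis]
  rfl

/-- The multiplication of paths, as a morphism of coalgebras. -/
noncomputable def mulHom : kQ ⊗[k] kQ →ₗc[k] kQ where
  toLinearMap := mulLin β
  counit_comp := TensorProduct.ext (hom_ext k fun a b p => hom_ext k fun a' b' q => by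
    change Coalgebra.counit (R := k) (mulLin β (path k p ⊗ₜ path k q)) =
      Coalgebra.counit (R := k) (path k p ⊗ₜ[k] path k q)
    rw [mulLin_path, counit_mulPath, TensorProduct.counit_tmul, smul_eq_mul, mul_comm])
  map_comp_comul := TensorProduct.ext (hom_ext k fun a b p => hom_ext k fun a' b' q => by
    change TensorProduct.map (mulLin β) (mulLin β) (Coalgebra.comul (path k p ⊗ₜ[k] path k q)) =
      Coalgebra.comul (mulLin β (path k p ⊗ₜ path k q))
    rw [comul_path_tmul_path, mulLin_path, comul_mulPath]
    simp only [map_list_sum, List.map_map, Function.comp_def, TensorProduct.map_tmul, mulLin_path])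

theorem mulHom_path {a b a' b' : HopfQuiver R} (p : Quiver.Path a b) (q : Quiver.Path a' b') :
    mulHom β (path k p ⊗ₜ path k q) = mulPath β p q :=
  mulLin_path β p q

theorem mulHom_vertex (a b : HopfQuiver R) :
    mulHom β (vertex k a ⊗ₜ vertex k b) = vertex k (a * b) := by
  rw [vertex, vertex, mulHom_path, mulPath]

theorem mulHom_vertex_toPath (g : HopfQuiver R) {a b : HopfQuiver R} (e : a ⟶ b) :
    mulHom β (vertex k g ⊗ₜ path k e.toPath) = path k (leftShift g e).toPath := by
  rw [vertex, mulHom_path, Quiver.Hom.toPath, mulPath, mulPath, consL_vertex]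

theorem mulHom_toPath_vertex (g : HopfQuiver R) {a b : HopfQuiver R} (e : a ⟶ b) :
    mulHom β (path k e.toPath ⊗ₜ vertex k g) =
      braidingScalar β a b g • path k (rightShift e g).toPath := by
  rw [vertex, mulHom_path, Quiver.Hom.toPath, mulPath, mulPath, consL_vertex]

theorem mulHom_mem_degree (m n : ℕ) (x y : kQ) (hx : x ∈ degree k (HopfQuiver R) m)
    (hy : y ∈ degree k (HopfQuiver R) n) : mulHom β (x ⊗ₜ y) ∈ degree k (HopfQuiver R) (m + n) := by
  refine map_mem_of_path (F := (TensorProduct.curry (mulLin β)).flip y)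
    (N := fun m => degree k (HopfQuiver R) (m + n)) (fun a b p => ?_) m x hx
  refine map_mem_of_path (F := TensorProduct.curry (mulLin β) (path k p))
    (N := fun n => degree k (HopfQuiver R) (p.length + n)) (fun a' b' q => ?_) n y hy
  rw [TensorProduct.curry_apply, mulLin_path]
  exact mulPath_mem_degree β p q

/-- Both bracketings are graded coalgebra morphisms, so it suffices to treat three vertices, or one
arrow and two vertices. These cases say that the arrow spans form a `G`-bimodule. -/
theorem mulHom_assoc (x y z : kQ) :
    mulHom β (mulHom β (x ⊗ₜ y) ⊗ₜ z) = mulHom β (x ⊗ₜ mulHom β (y ⊗ₜ z)) := by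
  suffices key : (mulHom β).comp (Coalgebra.TensorProduct.map (mulHom β) (CoalgHom.id k kQ)) =
      ((mulHom β).comp (Coalgebra.TensorProduct.map (CoalgHom.id k kQ) (mulHom β))).comp
        (Coalgebra.TensorProduct.assoc k k kQ kQ kQ).toCoalgHom from
    DFunLike.congr_fun key ((x ⊗ₜ y) ⊗ₜ z)
  refine hom_tensor_tensor_eq_of_eq_on_arrows ?_ ?_ ?_
  · exact fun _ _ _ _ _ _ p q r => mulHom_mem_degree β _ _ _ _ (mulHom_mem_degree β _ _ _ _
      (path_mem_degree p rfl) (path_mem_degree q rfl)) (path_mem_degree r rfl)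
  · intro _ _ _ _ _ _ p q r
    rw [add_assoc]
    exact mulHom_mem_degree β _ _ _ _ (path_mem_degree p rfl) (mulHom_mem_degree β _ _ _ _
      (path_mem_degree q rfl) (path_mem_degree r rfl))
  · intro a b a' b' a'' b'' p q r h
    change mulHom β (mulHom β (path k p ⊗ₜ path k q) ⊗ₜ path k r) =
      mulHom β (path k p ⊗ₜ mulHom β (path k q ⊗ₜ path k r))
    match p, q, r, h with
    | .nil, .nil, .nil, _ =>
      simp only [← vertex_eq_path, mulHom_vertex, mul_assoc]
    | .cons .nil e, .nil, .nil, _ =>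
      change mulHom β (mulHom β (path k e.toPath ⊗ₜ vertex k a') ⊗ₜ vertex k a'') =
        mulHom β (path k e.toPath ⊗ₜ mulHom β (vertex k a' ⊗ₜ vertex k a''))
      rw [mulHom_toPath_vertex, ← TensorProduct.smul_tmul', map_smul, mulHom_toPath_vertex,
        mulHom_vertex, mulHom_toPath_vertex, smul_smul,
        path_toPath_congr (mul_assoc _ _ _) (mul_assoc _ _ _) _ (rightShift e (a' * a'')) rfl]
      congr 1
      simp only [braidingScalar, β.map_mul_left, β.map_mul_right]
      -- Acting first by `a'` adds the factor `β(a',a'') β(a'',a')`, which is 1 by skew symmetry.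
      linear_combination (β.toFun a a' * β.toFun a' b * β.toFun a a'' * β.toFun a'' b) *
        β.skew a' a''
    | .nil, .cons .nil e, .nil, _ =>
      change mulHom β (mulHom β (vertex k a ⊗ₜ path k e.toPath) ⊗ₜ vertex k a'') =
        mulHom β (vertex k a ⊗ₜ mulHom β (path k e.toPath ⊗ₜ vertex k a''))
      rw [mulHom_toPath_vertex, TensorProduct.tmul_smul, map_smul, mulHom_vertex_toPath,
        mulHom_vertex_toPath, mulHom_toPath_vertex,
        path_toPath_congr (mul_assoc _ _ _) (mul_assoc _ _ _) _ (leftShift a (rightShift e a''))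
          rfl]
      congr 1
      simp only [braidingScalar, β.map_mul_left, β.map_mul_right]
      linear_combination (β.toFun a' a'' * β.toFun a'' b') * β.skew a a''
    | .nil, .nil, .cons .nil e, _ =>
      change mulHom β (mulHom β (vertex k a ⊗ₜ vertex k a') ⊗ₜ path k e.toPath) =
        mulHom β (vertex k a ⊗ₜ mulHom β (vertex k a' ⊗ₜ path k e.toPath))
      rw [mulHom_vertex, mulHom_vertex_toPath, mulHom_vertex_toPath, mulHom_vertex_toPath,
        path_toPath_congr (mul_assoc _ _ _) (mul_assoc _ _ _) _ (leftShift a (leftShift a' e)) rfl]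
    | .cons (.cons _ _) _, _, _, h => simp at h; lia
    | _, .cons (.cons _ _) _, _, h => simp at h; lia
    | _, _, .cons (.cons _ _) _, h => simp at h; lia
    | .cons .nil _, .cons .nil _, _, h => simp at h; lia
    | .cons .nil _, _, .cons .nil _, h => simp at h
    | _, .cons .nil _, .cons .nil _, h => simp at h

theorem mulHom_one_left (x : kQ) : mulHom β (vertex k (1 : HopfQuiver R) ⊗ₜ x) = x := by
  suffices key : TensorProduct.curry (mulLin β) (vertex k (1 : HopfQuiver R)) = LinearMap.id from
    LinearMap.congr_fun key x
  refine hom_ext k fun a b p => ?_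
  rw [TensorProduct.curry_apply, vertex, mulLin_path, one_mulPath, LinearMap.id_apply]

theorem mulHom_one_right (x : kQ) : mulHom β (x ⊗ₜ vertex k (1 : HopfQuiver R)) = x := by
  suffices key : (TensorProduct.curry (mulLin β)).flip (vertex k (1 : HopfQuiver R)) =
      LinearMap.id from LinearMap.congr_fun key x
  refine hom_ext k fun a b p => ?_
  rw [LinearMap.flip_apply, TensorProduct.curry_apply, vertex, mulLin_path, mulPath_one,
    LinearMap.id_apply]

/-- An antipode is a convolution inverse of the identity. The identity is invertible on vertices
because `G` is a group, and `exists_convInverse` propagates this to all paths. -/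
theorem exists_antipode : ∃ s : kQ →ₗ[k] kQ,
    (∀ x, mulHom β (TensorProduct.map s LinearMap.id (Coalgebra.comul (R := k) x)) =
      Coalgebra.counit (R := k) x • vertex k (1 : HopfQuiver R)) ∧
    (∀ x, mulHom β (TensorProduct.map LinearMap.id s (Coalgebra.comul (R := k) x)) =
      Coalgebra.counit (R := k) x • vertex k (1 : HopfQuiver R)) ∧
    ∀ (n : ℕ) (x : kQ), x ∈ degree k (HopfQuiver R) n → s x ∈ degree k (HopfQuiver R) n := by
  let ring : Ring kQ :=
    { (inferInstance : AddCommGroup kQ) with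
      mul := fun x y => mulHom β (x ⊗ₜ y)
      one := vertex k (1 : HopfQuiver R)
      mul_assoc := mulHom_assoc β
      one_mul := mulHom_one_left β
      mul_one := mulHom_one_right β
      left_distrib := fun x y z => by
        change mulHom β (x ⊗ₜ (y + z)) = mulHom β (x ⊗ₜ y) + mulHom β (x ⊗ₜ z)
        rw [TensorProduct.tmul_add, map_add]
      right_distrib := fun x y z => by
        change mulHom β ((x + y) ⊗ₜ z) = mulHom β (x ⊗ₜ z) + mulHom β (y ⊗ₜ z)
        rw [TensorProduct.add_tmul, map_add]
      zero_mul := fun x => by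
        change mulHom β (0 ⊗ₜ x) = 0
        rw [TensorProduct.zero_tmul, map_zero]
      mul_zero := fun x => by
        change mulHom β (x ⊗ₜ 0) = 0
        rw [TensorProduct.tmul_zero, map_zero] }
  let algebra : Algebra k kQ := Algebra.ofModule
    (fun r x y => by
      change mulHom β ((r • x) ⊗ₜ y) = r • mulHom β (x ⊗ₜ y)
      rw [← TensorProduct.smul_tmul', map_smul])
    (fun r x y => by
      change mulHom β (x ⊗ₜ (r • y)) = r • mulHom β (x ⊗ₜ y)
      rw [TensorProduct.tmul_smul, map_smul])
  have hm : ∀ z : kQ ⊗[k] kQ, mulHom β z = LinearMap.mul' k kQ z :=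
    HopfStructure.apply_eq_mul' (B := kQ) (mulLin β) (fun _ _ => rfl)
  let g : kQ →ₗ[k] kQ := (basis k).constr k fun p =>
    if p.length = 0 then vertex k p.1⁻¹ else 0
  have hg : ∀ {a b : HopfQuiver R} (p : Quiver.Path a b), g (path k p) =
      if p.length = 0 then vertex k a⁻¹ else 0 := fun p => Module.Basis.constr_basis ..
  have hgv : ∀ a : HopfQuiver R, g (vertex k a) = vertex k a⁻¹ := fun a => (hg _).trans (if_pos rfl)
  obtain ⟨s, h1, h2, h3⟩ := exists_convInverse (k := k) (A := kQ) LinearMap.id g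
    (fun a => by
      change mulHom β (vertex k a ⊗ₜ g (vertex k a)) = vertex k 1
      rw [hgv, mulHom_vertex, mul_inv_cancel])
    (fun a => by
      change mulHom β (g (vertex k a) ⊗ₜ vertex k a) = vertex k 1
      rw [hgv, mulHom_vertex, inv_mul_cancel])
    (degree k (HopfQuiver R)) (vertex_mem_degree _) (mulHom_mem_degree β)
    (fun a b p => path_mem_degree p rfl)
    (fun a b p => by
      rw [hg]
      split_ifs with h
      · rw [h]; exact vertex_mem_degree _
      · exact zero_mem _)
  refine ⟨s, fun x => ?_, fun x => ?_, map_mem_of_path h3⟩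
  · rw [hm]
    refine (LinearMap.congr_fun (congrArg WithConv.ofConv h1) x).trans ?_
    exact Algebra.algebraMap_eq_smul_one (R := k) (A := kQ) (Coalgebra.counit (R := k) x)
  · rw [hm]
    refine (LinearMap.congr_fun (congrArg WithConv.ofConv h2) x).trans ?_
    exact Algebra.algebraMap_eq_smul_one (R := k) (A := kQ) (Coalgebra.counit (R := k) x)

/-- The Hopf structure on the path coalgebra defined by a skew-symmetric bicharacter. -/
noncomputable def shuffleHopf : HopfStructure k kQ where
  mul := mulHom β
  one := vertex k (1 : HopfQuiver R)
  mul_assoc := mulHom_assoc β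
  one_mul := mulHom_one_left β
  mul_one := mulHom_one_right β
  comul_one := comul_vertex _
  counit_one := counit_vertex _
  antipode := (exists_antipode β).choose
  mul_antipode_left := (exists_antipode β).choose_spec.1
  mul_antipode_right := (exists_antipode β).choose_spec.2.1

/-! ### The universal form defined by a bicharacter -/

/-- The extension by zero of a bicharacter to a form on the path coalgebra. -/
noncomputable def formLin : kQ ⊗[k] kQ →ₗ[k] k :=
  TensorProduct.lift ((basis k).constr k fun p => (basis k).constr k fun q =>
    if p.length = 0 then if q.length = 0 then β.toFun p.1 q.1 else 0 else 0)

theorem formLin_path {a b a' b' : HopfQuiver R} (p : Quiver.Path a b) (q : Quiver.Path a' b') :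
    formLin β (path k p ⊗ₜ path k q) =
      if p.length = 0 then if q.length = 0 then β.toFun a a' else 0 else 0 := by
  rw [formLin, TensorProduct.lift.tmul, path, path, Module.Basis.constr_basis,
    Module.Basis.constr_basis]
  rfl

theorem formLin_vertex (a b : HopfQuiver R) :
    formLin β (vertex k a ⊗ₜ vertex k b) = β.toFun a b := by
  rw [vertex, vertex, formLin_path]; rfl

theorem formLin_eq_zero (m n : ℕ) (x y : kQ) (hx : x ∈ degree k (HopfQuiver R) m)
    (hy : y ∈ degree k (HopfQuiver R) n) (hmn : ¬(m = 0 ∧ n = 0)) :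
    formLin β (x ⊗ₜ y) = 0 := by
  have := map_mem_of_path (F := (TensorProduct.curry (formLin β)).flip y)
    -- The vanishing is encoded as membership in the zero submodule, with no condition imposed when
    -- both degrees are 0.
    (N := fun m => if m = 0 ∧ n = 0 then ⊤ else ⊥) (fun a b p => ?_) m x hx
  · simpa [hmn] using this
  have := map_mem_of_path (F := TensorProduct.curry (formLin β) (path k p))
    (N := fun n => if p.length = 0 ∧ n = 0 then ⊤ else ⊥) (fun a' b' q => ?_) n y hy
  · exact this
  rw [TensorProduct.curry_apply, formLin_path]
  split_ifs <;> simp_all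

/-- The form sees only vertices, so only the splits with trivial initial pieces survive, and the
form is evaluated at the two sources. -/
theorem sum_formLin_smul_later {M : Type*} [AddCommGroup M] [Module k M]
    {a b a' b' : HopfQuiver R} (p : Quiver.Path a b) (q : Quiver.Path a' b')
    (X : kQ ⊗[k] kQ →ₗ[k] M) :
    ((pathSplits p).map fun s => ((pathSplits q).map fun t =>
        formLin β (path k s.earlier ⊗ₜ path k t.earlier) •
          X (path k s.later ⊗ₜ[k] path k t.later)).sum).sum =
      β.toFun a a' • X (path k p ⊗ₜ path k q) := by
  have hq : ∀ s : PathSplit a b, ((pathSplits q).map fun t =>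
      formLin β (path k s.earlier ⊗ₜ path k t.earlier) •
        X (path k s.later ⊗ₜ[k] path k t.later)).sum =
      if s.earlier.length = 0 then β.toFun a a' • X (path k s.later ⊗ₜ[k] path k q) else 0 := by
    intro s
    simp only [formLin_path]
    split_ifs with h
    · simp only [ite_smul, zero_smul]
      exact splits_right q fun _ l _ => β.toFun a a' • X (path k s.later ⊗ₜ[k] path k l)
    · simp
  simp only [hq]
  exact splits_right p fun _ l _ => β.toFun a a' • X (path k l ⊗ₜ[k] path k q)

theorem sum_formLin_smul_earlier {M : Type*} [AddCommGroup M] [Module k M]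
    {a b a' b' : HopfQuiver R} (p : Quiver.Path a b) (q : Quiver.Path a' b')
    (X : kQ ⊗[k] kQ →ₗ[k] M) :
    ((pathSplits p).map fun s => ((pathSplits q).map fun t =>
        formLin β (path k s.later ⊗ₜ path k t.later) •
          X (path k s.earlier ⊗ₜ[k] path k t.earlier)).sum).sum =
      β.toFun b b' • X (path k p ⊗ₜ path k q) := by
  -- `formLin` is defined through sources; for paths of length zero these agree with the end
  -- vertices needed here.
  have hmid : ∀ {c d c' d' : HopfQuiver R} (l : Quiver.Path c d) (l' : Quiver.Path c' d'),
      formLin β (path k l ⊗ₜ path k l') =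
        if l.length = 0 then if l'.length = 0 then β.toFun d d' else 0 else 0 := by
    intro c d c' d' l l'
    rw [formLin_path]
    split_ifs with h h'
    · rw [Quiver.Path.eq_of_length_zero l h, Quiver.Path.eq_of_length_zero l' h']
    all_goals rfl
  have hq : ∀ s : PathSplit a b, ((pathSplits q).map fun t =>
      formLin β (path k s.later ⊗ₜ path k t.later) •
        X (path k s.earlier ⊗ₜ[k] path k t.earlier)).sum =
      if s.later.length = 0 then β.toFun b b' • X (path k s.earlier ⊗ₜ[k] path k q) else 0 := by
    intro s
    simp only [hmid]
    split_ifs with h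
    · simp only [ite_smul, zero_smul]
      exact splits_left q fun _ _ l => β.toFun b b' • X (path k s.earlier ⊗ₜ[k] path k l)
    · simp
  simp only [hq]
  exact splits_left p fun _ _ l => β.toFun b b' • X (path k l ⊗ₜ[k] path k q)

/-- The transpose of a skew-symmetric bicharacter. -/
def _root_.SkewSymmetricBicharacter.swap {k : Type v} [Field k] {G : Type u} [Group G]
    (β : SkewSymmetricBicharacter k G) : SkewSymmetricBicharacter k G where
  toFun g h := β.toFun h g
  map_mul_right f g h := β.map_mul_left g h f
  map_mul_left f g h := β.map_mul_right h f g
  map_one_right := β.map_one_left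
  map_one_left := β.map_one_right
  skew g h := β.skew h g

/-- On vertices this is skew symmetry; off vertices both sides vanish. -/
theorem toConv_formLin_mul_swap :
    WithConv.toConv (formLin β) * WithConv.toConv (formLin β.swap) = 1 := by
  refine WithConv.ofConv_injective (TensorProduct.ext
    (hom_ext k fun a b p => hom_ext k fun a' b' q => ?_))
  change LinearMap.mul' k k (TensorProduct.map (formLin β) (formLin β.swap)
    (Coalgebra.comul (R := k) (path k p ⊗ₜ[k] path k q))) =
      Coalgebra.counit (R := k) (path k p ⊗ₜ[k] path k q)
  rw [comul_path_tmul_path]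
  simp only [map_list_sum, List.map_map, Function.comp_def, TensorProduct.map_tmul,
    LinearMap.mul'_apply]
  refine (sum_formLin_smul_earlier β p q (formLin β.swap)).trans ?_
  rw [formLin_path, TensorProduct.counit_tmul, counit_path, counit_path]
  split_ifs with hp hq
  · rw [← Quiver.Path.eq_of_length_zero p hp, ← Quiver.Path.eq_of_length_zero q hq]
    simpa using! β.skew a a'
  all_goals simp

theorem isUnit_toConv_formLin : IsUnit (WithConv.toConv (formLin β)) :=
  -- The opposite composite is the same identity for the transpose, whose transpose is `β` again.
  ⟨⟨_, _, toConv_formLin_mul_swap β, toConv_formLin_mul_swap β.swap⟩, rfl⟩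

/-- Unless all three paths are vertices, both sides vanish for degree reasons; on vertices it is
multiplicativity of `β`. -/
theorem formLin_mul_left (x y z : kQ) : formLin β (mulHom β (x ⊗ₜ y) ⊗ₜ z) =
    LinearMap.mul' k k (TensorProduct.map (TensorProduct.curry (formLin β) x)
      (TensorProduct.curry (formLin β) y) (Coalgebra.comul (R := k) z)) := by
  induction x using induction_on with
  | zero => simp
  | add x x' hx hx' =>
    simp only [TensorProduct.add_tmul, map_add, TensorProduct.map_add_left, LinearMap.add_apply,
      hx, hx']
  | smul r x hx =>
    simp only [← TensorProduct.smul_tmul', map_smul, TensorProduct.map_smul_left,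
      LinearMap.smul_apply, hx]
  | path a b p =>
  induction y using induction_on with
  | zero => simp
  | add y y' hy hy' =>
    simp only [TensorProduct.add_tmul, TensorProduct.tmul_add, map_add,
      TensorProduct.map_add_right, LinearMap.add_apply, hy, hy']
  | smul r y hy =>
    simp only [← TensorProduct.smul_tmul', TensorProduct.tmul_smul, map_smul,
      TensorProduct.map_smul_right, LinearMap.smul_apply, hy]
  | path a' b' q =>
  induction z using induction_on with
  | zero => simp
  | add z z' hz hz' => simp only [TensorProduct.tmul_add, map_add, hz, hz']
  | smul r z hz => simp only [TensorProduct.tmul_smul, map_smul, hz]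
  | path a'' b'' r =>
  by_cases h : p.length = 0 ∧ q.length = 0 ∧ r.length = 0
  · match p, q, r, h with
    | .nil, .nil, .nil, _ =>
      simp only [← vertex_eq_path, mulHom_vertex, formLin_vertex, comul_vertex,
        TensorProduct.map_tmul, TensorProduct.curry_apply, LinearMap.mul'_apply, β.map_mul_left]
  · rw [formLin_eq_zero β (p.length + q.length) r.length _ _ (mulHom_mem_degree β _ _ _ _
      (path_mem_degree p rfl) (path_mem_degree q rfl)) (path_mem_degree r rfl) (by lia), comul_path]
    simp only [map_list_sum, List.map_map, Function.comp_def, TensorProduct.map_tmul,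
      LinearMap.mul'_apply, TensorProduct.curry_apply, formLin_path]
    refine (List.sum_eq_zero fun c hc => ?_).symm
    obtain ⟨s, hs, rfl⟩ := List.mem_map.1 hc
    have := length_add_length_of_mem_pathSplits r s hs
    split_ifs <;> lia

theorem formLin_mul_right (x y z : kQ) : formLin β (x ⊗ₜ mulHom β (y ⊗ₜ z)) =
    LinearMap.mul' k k (TensorProduct.map ((TensorProduct.curry (formLin β)).flip z)
      ((TensorProduct.curry (formLin β)).flip y) (Coalgebra.comul (R := k) x)) := by
  induction y using induction_on with
  | zero => simp
  | add y y' hy hy' =>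
    simp only [TensorProduct.add_tmul, TensorProduct.tmul_add, map_add,
      TensorProduct.map_add_right, LinearMap.add_apply, hy, hy']
  | smul r y hy =>
    simp only [← TensorProduct.smul_tmul', TensorProduct.tmul_smul, map_smul,
      TensorProduct.map_smul_right, LinearMap.smul_apply, hy]
  | path a' b' q =>
  induction z using induction_on with
  | zero => simp
  | add z z' hz hz' =>
    simp only [TensorProduct.tmul_add, map_add, TensorProduct.map_add_left, LinearMap.add_apply,
      hz, hz']
  | smul r z hz =>
    simp only [TensorProduct.tmul_smul, map_smul, TensorProduct.map_smul_left,
      LinearMap.smul_apply, hz]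
  | path a'' b'' r =>
  induction x using induction_on with
  | zero => simp
  | add x x' hx hx' => simp only [TensorProduct.add_tmul, map_add, hx, hx']
  | smul r x hx => simp only [← TensorProduct.smul_tmul', map_smul, hx]
  | path a b p =>
  by_cases h : p.length = 0 ∧ q.length = 0 ∧ r.length = 0
  · match p, q, r, h with
    | .nil, .nil, .nil, _ =>
      simp only [← vertex_eq_path, mulHom_vertex, formLin_vertex, comul_vertex,
        TensorProduct.map_tmul, LinearMap.flip_apply, TensorProduct.curry_apply,
        LinearMap.mul'_apply, β.map_mul_right, mul_comm]
  · rw [formLin_eq_zero β p.length (q.length + r.length) _ _ (path_mem_degree p rfl)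
      (mulHom_mem_degree β _ _ _ _ (path_mem_degree q rfl) (path_mem_degree r rfl)) (by lia),
      comul_path]
    simp only [map_list_sum, List.map_map, Function.comp_def, TensorProduct.map_tmul,
      LinearMap.mul'_apply, LinearMap.flip_apply, TensorProduct.curry_apply, formLin_path]
    refine (List.sum_eq_zero fun c hc => ?_).symm
    obtain ⟨s, hs, rfl⟩ := List.mem_map.1 hc
    have := length_add_length_of_mem_pathSplits p s hs
    split_ifs <;> lia

/-- Concentration in degree 0 leaves one term on each side, with `β` evaluated at the sources on the
left and at the targets on the right; `toFun_smul_mulPath_comm` compares them. -/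
theorem formLin_comm (hab : ∀ a b : HopfQuiver R, a * b = b * a) (x y : kQ) :
    TensorProduct.rid k kQ (TensorProduct.map
      (mulLin β ∘ₗ (TensorProduct.comm k kQ kQ).toLinearMap) (formLin β)
      (Coalgebra.comul (R := k) (x ⊗ₜ[k] y))) =
    TensorProduct.lid k kQ (TensorProduct.map (formLin β) (mulLin β)
      (Coalgebra.comul (R := k) (x ⊗ₜ[k] y))) := by
  suffices key : (TensorProduct.rid k kQ).toLinearMap ∘ₗ (TensorProduct.map
      (mulLin β ∘ₗ (TensorProduct.comm k kQ kQ).toLinearMap) (formLin β)) ∘ₗ Coalgebra.comul =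
    (TensorProduct.lid k kQ).toLinearMap ∘ₗ (TensorProduct.map (formLin β) (mulLin β)) ∘ₗ
      Coalgebra.comul from LinearMap.congr_fun key (x ⊗ₜ y)
  refine TensorProduct.ext (hom_ext k fun a b p => hom_ext k fun a' b' q => ?_)
  change TensorProduct.rid k kQ (TensorProduct.map
      (mulLin β ∘ₗ (TensorProduct.comm k kQ kQ).toLinearMap) (formLin β)
      (Coalgebra.comul (R := k) (path k p ⊗ₜ[k] path k q))) =
    TensorProduct.lid k kQ (TensorProduct.map (formLin β) (mulLin β)
      (Coalgebra.comul (R := k) (path k p ⊗ₜ[k] path k q)))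
  rw [comul_path_tmul_path]
  simp only [map_list_sum, List.map_map, Function.comp_def, TensorProduct.map_tmul,
    TensorProduct.rid_tmul, TensorProduct.lid_tmul]
  refine (sum_formLin_smul_later β p q _).trans (Eq.trans ?_
    (sum_formLin_smul_earlier β p q (mulLin β)).symm)
  rw [LinearMap.comp_apply, LinearEquiv.coe_coe, TensorProduct.comm_tmul, mulLin_path, mulLin_path]
  exact toFun_smul_mulPath_comm hab p q

/-- The graded coquasitriangular Hopf structure defined by a skew-symmetric bicharacter. -/
noncomputable def shuffleStructure (hab : ∀ a b : HopfQuiver R, a * b = b * a) :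
    DegreeZeroStructure k R where
  val :=
    { shuffleHopf β with
      mul_mem := mulHom_mem_degree β
      one_mem := vertex_mem_degree _
      antipode_mem := (exists_antipode β).choose_spec.2.2
      rForm := formLin β
      isUniversalRForm :=
        { isUnit := isUnit_toConv_formLin β
          mul_left := formLin_mul_left β
          mul_right := formLin_mul_right β
          comm := formLin_comm β hab } }
  property := ⟨mulHom_vertex β, formLin_eq_zero β⟩

end HopfQuiver

end Standard

/-! ### The classification -/

theorem theorem3p3 {k : Type v} [Field k] {G : Type u} [Group G] (R : ConjClasses G → ℕ)
    (hconn : IsConnectedQuiver (HopfQuiver R))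
    (hcqt : HopfQuiver.IsCoquasitriangular k R) :
    ∃ restrict : HopfQuiver.DegreeZeroStructure k R → SkewSymmetricBicharacter k G,
      (∀ (S : HopfQuiver.DegreeZeroStructure k R) (g h : G),
        (restrict S).toFun g h =
          S.1.rForm (HopfQuiver.groupVertex k R g ⊗ₜ HopfQuiver.groupVertex k R h)) ∧
      (∀ S T : HopfQuiver.DegreeZeroStructure k R,
        restrict S = restrict T ↔ HopfQuiver.DegreeZeroStructure.Iso S T) ∧
      Function.Surjective restrict := by
  refine ⟨fun S => S.bicharacter hconn, fun S g h => rfl, fun S T => ⟨fun h => ?_, fun h => ?_⟩,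
    fun β => ?_⟩
  · exact S.iso_of_form_eq T fun a b =>
      congrFun (congrFun (congrArg SkewSymmetricBicharacter.toFun h) a) b
  · exact SkewSymmetricBicharacter.ext (funext fun a => funext fun b => S.form_eq_of_iso T h a b)
  -- The given structure serves only to show that `G` is abelian; the preimage of `β` is built
  -- independently of it.
  · obtain ⟨S, hS⟩ := hcqt
    let β' : SkewSymmetricBicharacter k (HopfQuiver R) := β
    exact ⟨HopfQuiver.shuffleStructure β' (HopfQuiver.mul_comm_of_hasVertexGroup hS),
      SkewSymmetricBicharacter.ext (funext fun a => funext fun b =>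
        HopfQuiver.formLin_vertex β' a b)⟩
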